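/- The following decision problem is PSPACE-hard under logarithmic space many-one reductions: given a nondeterministic finite automaton $\mathcal A$ that defines a binary regular relation $R \subseteq \Sigma^* \times \Sigma^*$ over a finite alphabet $\Sigma$ (the alphabet being part of the input), decide whether $R$ is monadic decomposable. Here $\mathcal A$ defines $R$ if $\mathcal A$ is an automaton over the alphabet $(\Sigma\cup\{\bot\})^2$, with $\bot\notin\Sigma$ a padding symbol, that accepts exactly the words obtained from the pairs $(u,v)\in R$ by appending $\bot$'s to the shorter of the two words until both have length $\max(|u|,|v|)$ and then reading the two words in parallel. The relation $R$ is monadic decomposable if $R=\bigcup_{i=1}^m X_i\times Y_i$ for some finite $m$ and regular languages $X_i,Y_i\subseteq\Sigma^*$. PSPACE-hard means that for every language $K$ over a finite alphabet $A$ that is decided by a deterministic Turing machine in polynomial space there is a map computed by a logarithmic space transducer that sends each word $x\in A^*$ to (the encoding of) such an automaton, whose relation is monadic decomposable if and only if $x\in K$. (Automata are encoded by listing the alphabet size, number of states, initial state, final states and transitions, with numbers in unary.) -/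

import Mathlib

namespace MonDec

/-! ### Deterministic Turing machines and the class PSPACE -/

/-- Head movements. -/
inductive Move
  | left
  | stay
  | right

/-- New position of a head on a one-way infinite tape with cells `0, 1, 2, …`; a head that is
told to move left from cell `0` stays there. -/
def Move.apply : Move → ℕ → ℕ
  | .left, h => h - 1
  | .stay, h => h
  | .right, h => h + 1

/-- A deterministic single-tape Turing machine with input alphabet `A`. The tape alphabet consists
of the blank symbol `none`, the input letters and finitely many auxiliary symbols. The machine halts
when its (partial) transition function is undefined, and then it accepts iff its current state is
in `accept`. -/
structure TM (A : Type) where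
  State : Type
  [stateFintype : Fintype State]
  Aux : Type
  [auxFintype : Fintype Aux]
  start : State
  accept : Set State
  next : State → Option (A ⊕ Aux) → Option (State × Option (A ⊕ Aux) × Move)

namespace TM

variable {A : Type}

structure Config (M : TM A) where
  state : M.State
  head : ℕ
  tape : ℕ → Option (A ⊕ M.Aux)

/-- The input is written on cells `0, …, |x| - 1`, all other cells are blank. -/
def init (M : TM A) (x : List A) : M.Config where
  state := M.start
  head := 0
  tape := fun i => x[i]?.map Sum.inl

def Halted (M : TM A) (c : M.Config) : Prop :=
  M.next c.state (c.tape c.head) = none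

/-- One step of the machine; halted configurations stay unchanged. -/
def step (M : TM A) (c : M.Config) : M.Config :=
  match M.next c.state (c.tape c.head) with
  | none => c
  | some (q, s, d) =>
    { state := q
      head := d.apply c.head
      tape := Function.update c.tape c.head s }

/-- The configuration after `t` steps on input `x`. -/
def conf (M : TM A) (x : List A) (t : ℕ) : M.Config :=
  M.step^[t] (M.init x)

/-- `M` halts on every input, and it accepts exactly the words of `L`. -/
def Decides (M : TM A) (L : Language A) : Prop :=
  ∀ x : List A, ∃ t, M.Halted (M.conf x t) ∧ ((M.conf x t).state ∈ M.accept ↔ x ∈ L)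

/-- On every input `x`, only the first `s |x|` cells of the tape are ever scanned. -/
def RunsInSpace (M : TM A) (s : ℕ → ℕ) : Prop :=
  ∀ (x : List A) (t : ℕ), (M.conf x t).head < s x.length

end TM

/-- The class PSPACE of languages decided by a deterministic Turing machine in polynomial space. -/
def InPSPACE {A : Type} (L : Language A) : Prop :=
  ∃ (M : TM A) (p : Polynomial ℕ), M.Decides L ∧ M.RunsInSpace (fun n => p.eval n)

/-! ### Logarithmic space transducers -/

/-- What an input head can see: an end marker or a letter of the input. -/
inductive InputSym (A : Type)
  | leftEnd
  | letter (a : A)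
  | rightEnd

/-- A deterministic transducer with a read-only two-way input tape over `A`, finitely many
read-write work tapes, and a write-only one-way output tape over `B`. The transition function maps
the current state, the scanned input symbol and the scanned work symbols to a new state, a move
of the input head, a symbol to write and a move for every work tape, and at most one symbol to
be appended to the output. The machine halts when the transition function is undefined. -/
structure Transducer (A B : Type) where
  State : Type
  [stateFintype : Fintype State]
  Work : Type
  [workFintype : Fintype Work]
  blank : Work
  tapes : ℕ
  start : State
  next : State → InputSym A → (Fin tapes → Work) →
    Option (State × Move × (Fin tapes → Work × Move) × Option B)

namespace Transducer

variable {A B : Type}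

structure Config (T : Transducer A B) where
  state : T.State
  inputHead : ℕ
  heads : Fin T.tapes → ℕ
  work : Fin T.tapes → ℕ → T.Work
  output : List B

/-- The input tape holds the left end marker in cell `0`, the input word `x` in cells
`1, …, |x|`, and the right end marker in cell `|x| + 1`. -/
def readInput (x : List A) : ℕ → InputSym A
  | 0 => .leftEnd
  | i + 1 =>
    match x[i]? with
    | some a => .letter a
    | none => .rightEnd

def init (T : Transducer A B) : T.Config where
  state := T.start
  inputHead := 0
  heads := fun _ => 0
  work := fun _ _ => T.blank
  output := []

/-- The transition that is due in a configuration on input `x`, if any. -/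
def action (T : Transducer A B) (x : List A) (c : T.Config) :
    Option (T.State × Move × (Fin T.tapes → T.Work × Move) × Option B) :=
  T.next c.state (readInput x c.inputHead) (fun i => c.work i (c.heads i))

def Halted (T : Transducer A B) (x : List A) (c : T.Config) : Prop :=
  T.action x c = none

/-- One step of the transducer on input `x`; the input head cannot leave the cells
`0, …, |x| + 1`, and halted configurations stay unchanged. -/
def step (T : Transducer A B) (x : List A) (c : T.Config) : T.Config :=
  match T.action x c with
  | none => c
  | some (q, d, w, o) =>
    { state := q
      inputHead := min (d.apply c.inputHead) (x.length + 1)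
      heads := fun i => (w i).2.apply (c.heads i)
      work := fun i => Function.update (c.work i) (c.heads i) (w i).1
      output := c.output ++ o.toList }

/-- The configuration after `t` steps on input `x`. -/
def conf (T : Transducer A B) (x : List A) (t : ℕ) : T.Config :=
  (T.step x)^[t] T.init

/-- `T` halts on every input `x`, with output `f x`. -/
def Computes (T : Transducer A B) (f : List A → List B) : Prop :=
  ∀ x : List A, ∃ t, T.Halted x (T.conf x t) ∧ (T.conf x t).output = f x

/-- On every input `x`, only the first `s |x|` cells of each work tape are ever scanned. -/
def RunsInSpace (T : Transducer A B) (s : ℕ → ℕ) : Prop :=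
  ∀ (x : List A) (t : ℕ) (i : Fin T.tapes), (T.conf x t).heads i < s x.length

end Transducer

/-- `f` is computed by a transducer whose work tapes use `O(log n)` cells. -/
def LogspaceComputable {A B : Type} (f : List A → List B) : Prop :=
  ∃ (T : Transducer A B) (c : ℕ),
    T.Computes f ∧ T.RunsInSpace (fun n => c * (Nat.log 2 n + 1))

/-! ### Decision problems and PSPACE-hardness -/

/-- A decision problem: a type of instances, an unambiguous encoding of the instances as words
over a finite alphabet, and the set of the yes-instances. -/
structure DecisionProblem where
  Inst : Type
  Sym : Type
  [symFintype : Fintype Sym]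
  encode : Inst → List Sym
  encode_injective : Function.Injective encode
  Yes : Inst → Prop

/-- A logarithmic space many-one reduction from the language `L` to the problem `P`. -/
def LogspaceReducible {A : Type} (L : Language A) (P : DecisionProblem) : Prop :=
  ∃ f : List A → P.Inst,
    LogspaceComputable (fun x => P.encode (f x)) ∧ ∀ x : List A, x ∈ L ↔ P.Yes (f x)

/-- Every language in PSPACE, over any finite alphabet, is logspace reducible to `P`. -/
def PSPACEHard (P : DecisionProblem) : Prop :=
  ∀ (A : Type) [Fintype A] (L : Language A), InPSPACE L → LogspaceReducible L P

/-! ### Monadic decomposable relations and regular relations -/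

/-- A binary relation on words is monadic decomposable if it is a finite union of products of
regular languages. -/
def MonadicDecomposable {S : Type} (R : Set (List S × List S)) : Prop :=
  ∃ (m : ℕ) (X Y : Fin m → Language S),
    (∀ i, (X i).IsRegular ∧ (Y i).IsRegular) ∧
      R = ⋃ i, {w : List S × List S | w.1 ∈ X i ∧ w.2 ∈ Y i}

/-- `w` followed by padding symbols `none` up to length `l`. -/
def padTo {S : Type} (l : ℕ) (w : List S) : List (Option S) :=
  w.map some ++ List.replicate (l - w.length) none

/-- The pair `(u, v)` as a word over pairs of (possibly padding) symbols, where the shorter of the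
two words is padded at its end to the length of the longer one. -/
def padPair {S : Type} (w : List S × List S) : List (Option S × Option S) :=
  List.zip (padTo (max w.1.length w.2.length) w.1) (padTo (max w.1.length w.2.length) w.2)

/-- A two-tape synchronous nondeterministic finite automaton, as a finite object: its alphabet is
`{0, …, letters - 1}` with the padding symbol `none`, its states are `0, …, states - 1`, and the
final states and the transitions are listed. -/
structure PairNFA where
  letters : ℕ
  states : ℕ
  init : Fin states
  final : List (Fin states)
  trans : List (Fin states × Option (Fin letters) × Option (Fin letters) × Fin states)

namespace PairNFA

def toNFA (N : PairNFA) : NFA (Option (Fin N.letters) × Option (Fin N.letters)) (Fin N.states) where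
  step := fun p a => {q | (p, a.1, a.2, q) ∈ N.trans}
  start := {N.init}
  accept := {q | q ∈ N.final}

/-- The automaton defines the regular relation `R`: it recognizes exactly the language of the
padded pairs in `R`. -/
def Defines (N : PairNFA) (R : Set (List (Fin N.letters) × List (Fin N.letters))) : Prop :=
  ∀ z, z ∈ N.toNFA.accepts ↔ ∃ w ∈ R, padPair w = z

/-- Symbols of the encoding of automata. -/
inductive Code
  | one
  | sep
  | bar

instance : Fintype Code where
  elems := ⟨[Code.one, Code.sep, Code.bar], by simp⟩
  complete := fun c => by cases c <;> simp

/-- A natural number in unary, with a terminating symbol. -/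
def codeNat (k : ℕ) : List Code :=
  List.replicate k .one ++ [.sep]

def codeState {n : ℕ} (q : Fin n) : List Code :=
  codeNat q.val

/-- The padding symbol is coded by `0`, the letter `a` by `a + 1`. -/
def codeLetter {m : ℕ} : Option (Fin m) → List Code
  | none => codeNat 0
  | some a => codeNat (a + 1)

def codeTrans {m n : ℕ} (t : Fin n × Option (Fin m) × Option (Fin m) × Fin n) : List Code :=
  codeState t.1 ++ (codeLetter t.2.1 ++ (codeLetter t.2.2.1 ++ codeState t.2.2.2))

/-- The encoding of an automaton: sizes of the alphabet and of the state set, initial state, list of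
the final states, list of the transitions. -/
def encode (N : PairNFA) : List Code :=
  codeNat N.letters ++ (codeNat N.states ++ (codeState N.init ++
    (N.final.flatMap codeState ++ (.bar :: N.trans.flatMap codeTrans))))

theorem codeNat_append_inj {j k : ℕ} {u v : List Code}
    (h : codeNat j ++ u = codeNat k ++ v) : j = k ∧ u = v := by
  induction j generalizing k with
  | zero => cases k <;> simp_all [codeNat, List.replicate_succ]
  | succ j ih =>
    cases k with
    | zero => simp [codeNat, List.replicate_succ] at h
    | succ k =>
      have h2 : codeNat j ++ u = codeNat k ++ v := by
        simpa [codeNat, List.replicate_succ] using h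
      obtain ⟨rfl, rfl⟩ := ih h2
      exact ⟨rfl, rfl⟩

theorem codeLetter_append_inj {m : ℕ} {a b : Option (Fin m)} {u v : List Code}
    (h : codeLetter a ++ u = codeLetter b ++ v) : a = b ∧ u = v := by
  cases a <;> cases b <;> simp only [codeLetter] at h <;>
    obtain ⟨h1, rfl⟩ := codeNat_append_inj h <;> simp_all [Fin.ext_iff]

theorem codeTrans_append_inj {m n : ℕ}
    {s t : Fin n × Option (Fin m) × Option (Fin m) × Fin n} {u v : List Code}
    (h : codeTrans s ++ u = codeTrans t ++ v) : s = t ∧ u = v := by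
  obtain ⟨s1, s2, s3, s4⟩ := s
  obtain ⟨t1, t2, t3, t4⟩ := t
  simp only [codeTrans, codeState, List.append_assoc] at h
  obtain ⟨h1, h⟩ := codeNat_append_inj h
  obtain ⟨h2, h⟩ := codeLetter_append_inj h
  obtain ⟨h3, h⟩ := codeLetter_append_inj h
  obtain ⟨h4, h⟩ := codeNat_append_inj h
  refine ⟨?_, h⟩
  rw [h2, h3, Fin.ext h1, Fin.ext h4]

theorem codeFinal_inj {n : ℕ} {l r : List (Fin n)} {u v : List Code}
    (h : l.flatMap codeState ++ .bar :: u =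
      r.flatMap codeState ++ .bar :: v) : l = r ∧ u = v := by
  have key : ∀ (k : ℕ) (x y : List Code), .bar :: x ≠ codeNat k ++ y := by
    intro k x y
    cases k <;> simp [codeNat, List.replicate_succ]
  induction l generalizing r with
  | nil =>
    cases r with
    | nil => simpa using h
    | cons b r =>
      simp only [codeState, List.flatMap_nil, List.nil_append, List.flatMap_cons,
        List.append_assoc] at h
      exact absurd h (key _ _ _)
  | cons a l ih =>
    cases r with
    | nil =>
      simp only [codeState, List.flatMap_nil, List.nil_append, List.flatMap_cons,
        List.append_assoc] at h
      exact absurd h.symm (key _ _ _)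
    | cons b r =>
      simp only [List.flatMap_cons, List.append_assoc] at h
      obtain ⟨h1, h⟩ := codeNat_append_inj h
      obtain ⟨rfl, h2⟩ := ih h
      exact ⟨by rw [Fin.ext h1], h2⟩

theorem codeTransList_inj {m n : ℕ}
    {l r : List (Fin n × Option (Fin m) × Option (Fin m) × Fin n)}
    (h : l.flatMap codeTrans = r.flatMap codeTrans) : l = r := by
  induction l generalizing r with
  | nil =>
    cases r with
    | nil => rfl
    | cons b r => simp [codeTrans, codeState, codeNat] at h
  | cons a l ih =>
    cases r with
    | nil => simp [codeTrans, codeState, codeNat] at h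
    | cons b r =>
      simp only [List.flatMap_cons] at h
      obtain ⟨rfl, h1⟩ := codeTrans_append_inj h
      rw [ih h1]

theorem encode_injective : Function.Injective encode := by
  rintro ⟨m, n, i, f, t⟩ ⟨m', n', i', f', t'⟩ h
  simp only [encode] at h
  obtain ⟨rfl, h⟩ := codeNat_append_inj h
  obtain ⟨rfl, h⟩ := codeNat_append_inj h
  obtain ⟨h1, h⟩ := codeNat_append_inj h
  obtain ⟨rfl, h2⟩ := codeFinal_inj h
  obtain rfl := codeTransList_inj h2
  obtain rfl := Fin.ext h1
  rfl

end PairNFA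

/-- The problem of deciding whether a binary regular relation given by a nondeterministic
finite automaton is monadic decomposable. The instances are the automata that define a relation,
that is, the automata that accept nothing but padded pairs. -/
def monadicDecomposability : DecisionProblem where
  Inst := {N : PairNFA // ∃ R, N.Defines R}
  Sym := PairNFA.Code
  encode := fun N => N.1.encode
  encode_injective := fun _ _ h => Subtype.ext (PairNFA.encode_injective h)
  Yes := fun N => ∃ R, N.1.Defines R ∧ MonadicDecomposable R

end MonDec

namespace MonDec

/-! ### A nondeterministic search for deviations from a locally generated word -/

/-! Let `M` decide the language in polynomial space, and fix an input `x`. Choose `D` polynomial in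
the length of `x` and larger than the length and the space used. Write the configurations of `M` on
`x` one after another as an infinite word `W`, each taking `D + 2` letters: a separator and `D + 1`
cells. A halted machine repeats its last configuration, so `W` is always infinite. The input is
rejected exactly when `W` contains a bad letter, one that shows a halted non-accepting state
(`TM.rejecting_word`, `TM.mem_iff_not_rejecting`).

Call a word good if it is a prefix of `W` with a bad letter, and let `deviationRel` relate `u` and
`v` if `u` is not good or both have the same length. Without bad letters no word is good, and the
relation is everything. With a bad letter all long prefixes of `W` are good, and among pairs of good
words the relation is equality of lengths, which a finite union of products cannot express, by the
pigeonhole principle (`monadicDecomposable_deviationRel`).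

A small nondeterministic automaton recognizes this relation. Equality of lengths is visible in the
padding. Not being good has a local witness: there is no bad letter, or the first `D + 3` letters
are not those of `W`, or some letter differs from the one that three letters determine `D + 3`
positions earlier (`modeAccepts_pos_zero_iff_not_good`). The last two need only one counter with
values `0, …, D`; the other data of a state are bounded independently of `x`. Hence
`pairNFA_defines` and `yes_pairNFA`.

The code of the automaton is written by a loop over the counter, whose transitions depend on `x`
only through one letter of the first configuration. A calculus of transducer fragments with
registers in bijective base two turns this loop into a logarithmic space transducer
(`Frag.exec_emitAutomaton`, `fits_pow`, `TM.logspaceComputable_encode`). -/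

/-- A local rule, with a set of bad letters and two distinguished letters. -/
structure Rule (S : Type) where
  next : S → S → S → S
  bad : S → Prop
  hash : S
  blank : S

/-- The word `W` is generated by the rule: every letter from position `D + 3` on is determined by
three consecutive letters, and the letters before it end with `blank, hash`. -/
structure Rule.Generates {S : Type} (P : Rule S) (D : ℕ) (W : ℕ → S) : Prop where
  next : ∀ i, W (i + (D + 3)) = P.next (W i) (W (i + 1)) (W (i + 2))
  blank : W (D + 1) = P.blank
  hash : W (D + 2) = P.hash

/-- What the automaton is doing: comparing with the initial segment (`pos`, `posA`, `posB`), looking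
for the absence of bad letters (`clean`), choosing a position (`run`), remembering letters read there
(`one`, `two`), waiting for the letter to be compared with the given one (`wait`), or accepting all
continuations (`done`). -/
inductive Mode (S : Type)
  | pos
  | posA
  | posB
  | clean
  | run
  | one (a : S)
  | two (a b : S)
  | wait (a : S)
  | done

/-- `ModeStep P first last e m a m' inc`: reading `a`, the automaton may change from mode `m` to
mode `m'`, and its counter is incremented if `inc` holds and reset otherwise. The flags `first` and
`last` tell whether the counter is minimal or maximal; `e` is the letter expected in mode `pos`. -/
inductive ModeStep {S : Type} (P : Rule S) (first last : Bool) (e : S) :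
    Mode S → S → Mode S → Bool → Prop
  | posWrong {a : S} : a ≠ e → ModeStep P first last e .pos a .done false
  | posNext : last = false → ModeStep P first last e .pos e .pos true
  | posLast : last = true → ModeStep P first last e .pos e .posA false
  | posClean {a : S} : first = true → ¬ P.bad a → ModeStep P first last e .pos a .clean false
  | posRun {a : S} : first = true → ModeStep P first last e .pos a .run false
  | posOne {a : S} : first = true → ModeStep P first last e .pos a (.one a) false
  | posARight : first = true → ModeStep P first last e .posA P.blank .posB false
  | posAWrong {a : S} : first = true → a ≠ P.blank → ModeStep P first last e .posA a .done false
  | posBWrong {a : S} : first = true → a ≠ P.hash → ModeStep P first last e .posB a .done false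
  | clean {a : S} : first = true → ¬ P.bad a → ModeStep P first last e .clean a .clean false
  | run {a : S} : first = true → ModeStep P first last e .run a .run false
  | runOne {a : S} : first = true → ModeStep P first last e .run a (.one a) false
  | oneTwo {l a : S} : first = true → ModeStep P first last e (.one l) a (.two l a) false
  | twoWait {l c a : S} :
      first = true → ModeStep P first last e (.two l c) a (.wait (P.next l c a)) false
  | waitNext {z a : S} : last = false → ModeStep P first last e (.wait z) a (.wait z) true
  | waitWrong {z a : S} : last = true → a ≠ z → ModeStep P first last e (.wait z) a .done false
  | done {a : S} : first = true → ModeStep P first last e .done a .done false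

/-- The accepting modes. -/
inductive Mode.Final {S : Type} : Mode S → Prop
  | pos : Mode.Final .pos
  | clean : Mode.Final .clean
  | done : Mode.Final .done

variable {S : Type}

/-- Acceptance of a word from a given mode and value of the counter, which ranges over
`0, …, D`. -/
def ModeAccepts (P : Rule S) (D : ℕ) (W : ℕ → S) : Mode S → ℕ → List S → Prop
  | m, j, [] => j = 0 ∧ m.Final
  | m, j, a :: u => ∃ m' i, ModeStep P (decide (j = 0)) (decide (j = D)) (W j) m a m' i ∧
      ModeAccepts P D W m' (if i then j + 1 else 0) u

/-- Some letter of `u` differs from the one determined by three earlier letters. -/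
def Violates (P : Rule S) (D : ℕ) (u : List S) : Prop :=
  ∃ i l c r b, u[i]? = some l ∧ u[i + 1]? = some c ∧ u[i + 2]? = some r ∧
    u[i + (D + 3)]? = some b ∧ b ≠ P.next l c r

/-- `u` is a prefix of `W` that contains a bad letter. -/
def Good (P : Rule S) (W : ℕ → S) (u : List S) : Prop :=
  (∀ i b, u[i]? = some b → b = W i) ∧ ∃ a ∈ u, P.bad a

theorem Mode.final_iff {m : Mode S} : m.Final ↔ m = .pos ∨ m = .clean ∨ m = .done := by
  constructor
  · rintro (_ | _ | _) <;> simp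
  · rintro (rfl | rfl | rfl) <;> constructor

/-! ### The words accepted from each mode -/

section ModeAccepts

variable {P : Rule S} {D : ℕ} {W : ℕ → S}

theorem modeAccepts_done (u : List S) : ModeAccepts P D W .done 0 u := by
  induction u with
  | nil => exact ⟨rfl, .done⟩
  | cons a u ih => exact ⟨.done, false, .done (by simp), by simpa using ih⟩

theorem modeAccepts_clean {u : List S} :
    ModeAccepts P D W .clean 0 u ↔ ∀ a ∈ u, ¬ P.bad a := by
  induction u with
  | nil => simp [ModeAccepts, Mode.final_iff]
  | cons a u ih =>
    constructor
    · rintro ⟨m', i, h, hu⟩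
      cases h with
      | clean _ h => simpa [h] using ih.1 (by simpa using hu)
    · intro h
      exact ⟨.clean, false, .clean (by simp) (h a (by simp)),
        by simpa using ih.2 fun b hb => h b (by simp [hb])⟩

/-- The comparison takes place when the counter has reached `D`, so `D - j` letters are skipped
first. Entered with counter `0` just after the third letter of a window at `i`, the mode tests
position `i + 3 + D`, the one governed by the rule. -/
theorem modeAccepts_wait {z : S} {j : ℕ} (hj : j ≤ D) {u : List S} :
    ModeAccepts P D W (.wait z) j u ↔ ∃ b, u[D - j]? = some b ∧ b ≠ z := by
  induction u generalizing j with
  | nil => simp [ModeAccepts, Mode.final_iff]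
  | cons a u ih =>
    constructor
    · rintro ⟨m', i, h, hu⟩
      cases h with
      | waitNext h =>
        have h1 : j ≠ D := by simpa using h
        have h2 : D - j = D - (j + 1) + 1 := by omega
        rw [h2]
        simpa using (ih (j := j + 1) (by omega)).1 (by simpa using hu)
      | waitWrong h h' =>
        have h1 : j = D := by simpa using h
        exact ⟨a, by simp [h1], h'⟩
    · rintro ⟨b, hb, hbz⟩
      by_cases h1 : j = D
      · subst h1
        refine ⟨.done, false, .waitWrong (by simp) ?_, by simpa using modeAccepts_done u⟩
        simp only [Nat.sub_self, List.getElem?_cons_zero, Option.some.injEq] at hb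
        rwa [hb]
      · have h2 : D - j = D - (j + 1) + 1 := by omega
        rw [h2, List.getElem?_cons_succ] at hb
        refine ⟨.wait z, true, .waitNext (by simp [h1]), ?_⟩
        simpa using (ih (j := j + 1) (by omega)).2 ⟨b, hb, hbz⟩

theorem modeAccepts_two {l c : S} {u : List S} :
    ModeAccepts P D W (.two l c) 0 u ↔
      ∃ r b, u[0]? = some r ∧ u[D + 1]? = some b ∧ b ≠ P.next l c r := by
  cases u with
  | nil => simp [ModeAccepts, Mode.final_iff]
  | cons a u =>
    constructor
    · rintro ⟨m', i, h, hu⟩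
      cases h with
      | twoWait h =>
        obtain ⟨b, hb, hbz⟩ := (modeAccepts_wait (Nat.zero_le D)).1 (by simpa using hu)
        exact ⟨a, b, rfl, by simpa using hb, hbz⟩
    · rintro ⟨r, b, hr, hb, hbz⟩
      obtain rfl : a = r := by simpa using hr
      refine ⟨_, false, .twoWait (by simp), ?_⟩
      simpa using (modeAccepts_wait (P := P) (W := W) (Nat.zero_le D)).2
        ⟨b, by simpa using hb, hbz⟩

theorem modeAccepts_one {l : S} {u : List S} :
    ModeAccepts P D W (.one l) 0 u ↔
      ∃ c r b, u[0]? = some c ∧ u[1]? = some r ∧ u[D + 2]? = some b ∧ b ≠ P.next l c r := by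
  cases u with
  | nil => simp [ModeAccepts, Mode.final_iff]
  | cons a u =>
    constructor
    · rintro ⟨m', i, h, hu⟩
      cases h with
      | oneTwo h =>
        obtain ⟨r, b, hr, hb, hbz⟩ := modeAccepts_two.1 (by simpa using hu)
        exact ⟨a, r, b, rfl, by simpa using hr, by simpa using hb, hbz⟩
    · rintro ⟨c, r, b, hc, hr, hb, hbz⟩
      obtain rfl : a = c := by simpa using hc
      refine ⟨_, false, .oneTwo (by simp), ?_⟩
      simpa using modeAccepts_two.2 ⟨r, b, by simpa using hr, by simpa using hb, hbz⟩

/-- The window of a violation starts at the first letter or later; this matches the choice between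
remembering a letter and running on. -/
theorem violates_cons {a : S} {u : List S} :
    Violates P D (a :: u) ↔ ModeAccepts P D W (.one a) 0 u ∨ Violates P D u := by
  rw [modeAccepts_one]
  constructor
  · rintro ⟨i, l, c, r, b, hl, hc, hr, hb, hn⟩
    cases i with
    | zero =>
      obtain rfl : a = l := by simpa using hl
      left
      refine ⟨c, r, b, by simpa using hc, by simpa using hr, ?_, hn⟩
      simpa [Nat.add_comm] using hb
    | succ i =>
      right
      refine ⟨i, l, c, r, b, ?_, ?_, ?_, ?_, hn⟩
      · simpa using hl
      · simpa using hc
      · rwa [show i + 1 + 2 = i + 2 + 1 by ring, List.getElem?_cons_succ] at hr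
      · rwa [show i + 1 + (D + 3) = i + (D + 3) + 1 by ring, List.getElem?_cons_succ] at hb
  · rintro (⟨c, r, b, hc, hr, hb, hn⟩ | ⟨i, l, c, r, b, hl, hc, hr, hb, hn⟩)
    · exact ⟨0, a, c, r, b, by simp, by simpa using hc, by simpa using hr,
        by rwa [show 0 + (D + 3) = D + 2 + 1 by ring, List.getElem?_cons_succ], hn⟩
    · refine ⟨i + 1, l, c, r, b, by simpa using hl, by simpa using hc, ?_, ?_, hn⟩
      · rwa [show i + 1 + 2 = i + 2 + 1 by ring, List.getElem?_cons_succ]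
      · rwa [show i + 1 + (D + 3) = i + (D + 3) + 1 by ring, List.getElem?_cons_succ]

theorem modeAccepts_run {u : List S} : ModeAccepts P D W .run 0 u ↔ Violates P D u := by
  induction u with
  | nil => simp [ModeAccepts, Mode.final_iff, Violates]
  | cons a u ih =>
    rw [violates_cons (W := W), ← ih]
    constructor
    · rintro ⟨m', i, h, hu⟩
      cases h with
      | run h => exact .inr (by simpa using hu)
      | runOne h => exact .inl (by simpa using hu)
    · rintro (h | h)
      · exact ⟨_, false, .runOne (by simp), by simpa using h⟩
      · exact ⟨_, false, .run (by simp), by simpa using h⟩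

theorem modeAccepts_posB {u : List S} :
    ModeAccepts P D W .posB 0 u ↔ ∃ b, u[0]? = some b ∧ b ≠ P.hash := by
  cases u with
  | nil => simp [ModeAccepts, Mode.final_iff]
  | cons a u =>
    constructor
    · rintro ⟨m', i, h, hu⟩
      cases h with
      | posBWrong h h' => exact ⟨a, rfl, h'⟩
    · rintro ⟨b, hb, hn⟩
      obtain rfl : a = b := by simpa using hb
      exact ⟨_, false, .posBWrong (by simp) hn, by simpa using modeAccepts_done u⟩

theorem modeAccepts_posA {u : List S} :
    ModeAccepts P D W .posA 0 u ↔
      (∃ b, u[0]? = some b ∧ b ≠ P.blank) ∨ ∃ b, u[1]? = some b ∧ b ≠ P.hash := by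
  cases u with
  | nil => simp [ModeAccepts, Mode.final_iff]
  | cons a u =>
    constructor
    · rintro ⟨m', i, h, hu⟩
      cases h with
      | posAWrong h h' => exact .inl ⟨a, rfl, h'⟩
      | posARight h => exact .inr (by simpa using modeAccepts_posB.1 (by simpa using hu))
    · intro h
      by_cases ha : a = P.blank
      · subst ha
        have h1 : ∃ b, u[0]? = some b ∧ b ≠ P.hash := by simpa using h
        exact ⟨_, false, .posARight (by simp), by simpa using modeAccepts_posB.2 h1⟩
      · exact ⟨_, false, .posAWrong (by simp) ha, by simpa using modeAccepts_done u⟩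

/-- `u` deviates from the initial segment of `W` when it is placed at position `j`. -/
def Deviates (D : ℕ) (W : ℕ → S) (j : ℕ) (u : List S) : Prop :=
  ∃ i b, j + i ≤ D + 2 ∧ u[i]? = some b ∧ b ≠ W (j + i)

theorem deviates_cons {a : S} {j : ℕ} (hj : j ≤ D + 2) {u : List S} :
    Deviates D W j (a :: u) ↔ a ≠ W j ∨ Deviates D W (j + 1) u := by
  constructor
  · rintro ⟨i, b, hi, hb, hn⟩
    cases i with
    | zero =>
      obtain rfl : a = b := by simpa using hb
      exact .inl hn
    | succ i =>
      exact .inr ⟨i, b, by omega, by simpa using hb, by rwa [Nat.add_right_comm, Nat.add_assoc]⟩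
  · rintro (h | ⟨i, b, hi, hb, hn⟩)
    · exact ⟨0, a, by omega, rfl, h⟩
    · exact ⟨i + 1, b, by omega, by simpa using hb, by rwa [Nat.add_right_comm, Nat.add_assoc] at hn⟩

/-- Positions `D + 1` and `D + 2` are out of reach of the counter, but their letters are the same
for all inputs, so two modes without counter suffice for them. -/
theorem deviates_last (hW : P.Generates D W) {u : List S} :
    Deviates D W (D + 1) u ↔ ModeAccepts P D W .posA 0 u := by
  rw [modeAccepts_posA]
  constructor
  · rintro ⟨i, b, hi, hb, hn⟩
    obtain rfl | rfl : i = 0 ∨ i = 1 := by omega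
    · exact .inl ⟨b, hb, by simpa [hW.blank] using hn⟩
    · exact .inr ⟨b, hb, by simpa [hW.hash] using hn⟩
  · rintro (⟨b, hb, hn⟩ | ⟨b, hb, hn⟩)
    · exact ⟨0, b, by omega, hb, by simpa [hW.blank] using hn⟩
    · exact ⟨1, b, by omega, hb, by simpa [hW.hash] using hn⟩

/-- The other searches can be chosen only when the counter is `0`. Once it is positive the automaton
is committed to finding a deviation, and a word that ends too early is not accepted. -/
theorem modeAccepts_pos (hW : P.Generates D W) {j : ℕ} (h0 : j ≠ 0) (hj : j ≤ D) {u : List S} :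
    ModeAccepts P D W .pos j u ↔ Deviates D W j u := by
  induction u generalizing j with
  | nil => simp [ModeAccepts, h0, Deviates]
  | cons a u ih =>
    rw [deviates_cons (by omega)]
    constructor
    · rintro ⟨m', i, h, hu⟩
      cases h with
      | posWrong h => exact .inl h
      | posNext h =>
        have h1 : j ≠ D := by simpa using h
        exact .inr ((ih (by omega) (by omega)).1 (by simpa using hu))
      | posLast h =>
        obtain rfl : j = D := by simpa using h
        exact .inr ((deviates_last hW).2 (by simpa using hu))
      | posClean h => simp [h0] at h
      | posRun h => simp [h0] at h
      | posOne h => simp [h0] at h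
    · intro h
      by_cases ha : a = W j
      · subst ha
        have h1 := h.resolve_left (by simp)
        by_cases hD : j = D
        · subst hD
          exact ⟨_, false, .posLast (by simp), by simpa using (deviates_last hW).1 h1⟩
        · exact ⟨_, true, .posNext (by simp [hD]),
            by simpa using (ih (by omega) (by omega)).2 h1⟩
      · exact ⟨_, false, .posWrong ha, by simpa using modeAccepts_done u⟩

/-- The first letter is where one of the three searches is chosen. As `D ≠ 0`, the counter is not
yet maximal there, so the comparison goes on with counter `1`. -/
theorem modeAccepts_pos_zero (hW : P.Generates D W) (hD : D ≠ 0) {u : List S} :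
    ModeAccepts P D W .pos 0 u ↔
      (∀ a ∈ u, ¬ P.bad a) ∨ Violates P D u ∨ Deviates D W 0 u := by
  cases u with
  | nil => simp [ModeAccepts, Mode.final_iff]
  | cons a u =>
    rw [violates_cons (W := W), deviates_cons (by omega), zero_add,
      ← modeAccepts_pos hW one_ne_zero (by omega), ← modeAccepts_run (W := W)]
    constructor
    · rintro ⟨m', i, h, hu⟩
      cases h with
      | posWrong h => simp [h]
      | posNext h => exact .inr (.inr (.inr (by simpa using hu)))
      | posLast h => simp [hD.symm] at h
      | posClean h h' =>
        have := (modeAccepts_clean (P := P) (D := D) (W := W)).1 (by simpa using hu)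
        exact .inl (by simpa [h'] using this)
      | posRun h => exact .inr (.inl (.inr (by simpa using hu)))
      | posOne h => exact .inr (.inl (.inl (by simpa using hu)))
    · rintro (h | (h | h) | (h | h))
      · exact ⟨_, false, .posClean (by simp) (h a (by simp)), by
          simpa using modeAccepts_clean.2 fun b hb => h b (by simp [hb])⟩
      · exact ⟨_, false, .posOne (by simp), by simpa using h⟩
      · exact ⟨_, false, .posRun (by simp), by simpa using h⟩
      · exact ⟨_, false, .posWrong h, by simpa using modeAccepts_done u⟩
      · by_cases ha : a = W 0
        · subst ha
          exact ⟨_, true, .posNext (by simp [hD.symm]), by simpa using h⟩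
        · exact ⟨_, false, .posWrong ha, by simpa using modeAccepts_done u⟩

/-- A word without deviation and violation agrees with `W`, by strong induction on the position:
initially because nothing deviates, later because the three letters that determine the current one
already agree. -/
theorem modeAccepts_pos_zero_iff_not_good (hW : P.Generates D W) (hD : D ≠ 0) {u : List S} :
    ModeAccepts P D W .pos 0 u ↔ ¬ Good P W u := by
  rw [modeAccepts_pos_zero hW hD]
  constructor
  · rintro h ⟨hp, a, ha, hb⟩
    rcases h with h | ⟨i, l, c, r, b, hl, hc, hr, hb, hn⟩ | ⟨i, b, -, hb, hn⟩
    · exact h a ha hb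
    · rw [hp _ _ hl, hp _ _ hc, hp _ _ hr, hp _ _ hb] at hn
      exact hn (hW.next i)
    · rw [zero_add] at hn
      exact hn (hp _ _ hb)
  · intro h
    by_contra! h'
    obtain ⟨h1, h2, h3⟩ := h'
    refine h ⟨fun i => ?_, h1⟩
    induction i using Nat.strong_induction_on with
    | _ i ih =>
      intro b hb
      by_cases hi : i ≤ D + 2
      · by_contra hn
        exact h3 ⟨i, b, by omega, hb, by rwa [zero_add]⟩
      · obtain ⟨k, rfl⟩ : ∃ k, i = k + (D + 3) := ⟨i - (D + 3), by omega⟩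
        have hlen : k + (D + 3) < u.length := (List.getElem?_eq_some_iff.1 hb).1
        have hget : ∀ t, t < 3 → u[k + t]? = some (W (k + t)) := by
          intro t ht
          have hlt : k + t < u.length := by omega
          rw [List.getElem?_eq_getElem hlt, ih (k + t) (by omega) _ (List.getElem?_eq_getElem hlt)]
        by_contra hn
        rw [hW.next] at hn
        exact h2 ⟨k, _, _, _, b, hget 0 (by omega), hget 1 (by omega), hget 2 (by omega), hb, hn⟩

end ModeAccepts

/-! ### Padded pairs -/

section PadPair

variable {S : Type}

theorem padPair_nil : padPair (([], []) : List S × List S) = [] := rfl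

theorem padPair_cons_cons (a b : S) (u v : List S) :
    padPair (a :: u, b :: v) = (some a, some b) :: padPair (u, v) := by
  simp [padPair, padTo, Nat.succ_max_succ]

theorem padPair_cons_nil (a : S) (u : List S) :
    padPair (a :: u, []) = (some a, none) :: padPair (u, []) := by
  simp [padPair, padTo, List.replicate_succ]

theorem padPair_nil_cons (b : S) (v : List S) :
    padPair ([], b :: v) = (none, some b) :: padPair ([], v) := by
  simp [padPair, padTo, List.replicate_succ]

theorem padPair_eq_nil {w : List S × List S} : padPair w = [] ↔ w = ([], []) := by
  obtain ⟨_ | ⟨a, u⟩, _ | ⟨b, v⟩⟩ := w <;>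
    simp [padPair_nil, padPair_cons_cons, padPair_cons_nil, padPair_nil_cons]

theorem padPair_eq_both {w : List S × List S} {a b : S} {z : List (Option S × Option S)} :
    padPair w = (some a, some b) :: z ↔ ∃ u v, w = (a :: u, b :: v) ∧ padPair (u, v) = z := by
  obtain ⟨_ | ⟨a, u⟩, _ | ⟨b, v⟩⟩ := w <;>
    simp [padPair_nil, padPair_cons_cons, padPair_cons_nil, padPair_nil_cons, and_assoc]

theorem padPair_eq_left {w : List S × List S} {a : S} {z : List (Option S × Option S)} :
    padPair w = (some a, none) :: z ↔ ∃ u, w = (a :: u, []) ∧ padPair (u, []) = z := by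
  obtain ⟨_ | ⟨a, u⟩, _ | ⟨b, v⟩⟩ := w <;>
    simp [padPair_nil, padPair_cons_cons, padPair_cons_nil, padPair_nil_cons]

theorem padPair_eq_right {w : List S × List S} {b : S} {z : List (Option S × Option S)} :
    padPair w = (none, some b) :: z ↔ ∃ v, w = ([], b :: v) ∧ padPair ([], v) = z := by
  obtain ⟨_ | ⟨a, u⟩, _ | ⟨b, v⟩⟩ := w <;>
    simp [padPair_nil, padPair_cons_cons, padPair_cons_nil, padPair_nil_cons]

theorem padPair_ne_none_none {w : List S × List S} {z : List (Option S × Option S)} :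
    padPair w ≠ (none, none) :: z := by
  obtain ⟨_ | ⟨a, u⟩, _ | ⟨b, v⟩⟩ := w <;>
    simp [padPair_nil, padPair_cons_cons, padPair_cons_nil, padPair_nil_cons]

/-- Each column shows which of the two words are still running, so the pair can be read off column
by column. -/
theorem padPair_injective : Function.Injective (padPair (S := S)) := by
  suffices h : ∀ z : List (Option S × Option S), ∀ w w', padPair w = z → padPair w' = z → w = w' from
    fun w w' h' => h _ _ _ h' rfl
  intro z
  induction z with
  | nil => intro w w' h h'; rw [padPair_eq_nil.1 h, padPair_eq_nil.1 h']
  | cons x z ih =>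
    obtain ⟨_ | a, _ | b⟩ := x <;> intro w w' h h'
    · exact absurd h padPair_ne_none_none
    · obtain ⟨v, rfl, k⟩ := padPair_eq_right.1 h
      obtain ⟨v', rfl, k'⟩ := padPair_eq_right.1 h'
      simpa using ih _ _ k k'
    · obtain ⟨v, rfl, k⟩ := padPair_eq_left.1 h
      obtain ⟨v', rfl, k'⟩ := padPair_eq_left.1 h'
      simpa using ih _ _ k k'
    · obtain ⟨u, v, rfl, k⟩ := padPair_eq_both.1 h
      obtain ⟨u', v', rfl, k'⟩ := padPair_eq_both.1 h'
      simpa using ih _ _ k k'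

end PadPair

/-- The yes-instances speak of some relation defined by the automaton; uniqueness identifies it with
`deviationRel`. -/
theorem PairNFA.Defines.unique {N : PairNFA} {R R' : Set (List (Fin N.letters) × List (Fin N.letters))}
    (h : N.Defines R) (h' : N.Defines R') : R = R' := by
  have key : ∀ R₁ R₂ : Set (List (Fin N.letters) × List (Fin N.letters)),
      N.Defines R₁ → N.Defines R₂ → R₁ ⊆ R₂ := by
    intro R₁ R₂ h₁ h₂ w hw
    obtain ⟨w', hw', h⟩ := (h₂ _).1 ((h₁ _).2 ⟨w, hw, rfl⟩)
    rwa [← padPair_injective h]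
  exact (key R R' h h').antisymm (key R' R h' h)

/-! ### The relation and its monadic decomposability -/

/-- The pairs whose first word is not good or whose two words have the same length. -/
def deviationRel {S : Type} (P : Rule S) (W : ℕ → S) : Set (List S × List S) :=
  {w | ¬ Good P W w.1 ∨ w.1.length = w.2.length}

theorem isRegular_univ (S : Type) : Language.IsRegular (Set.univ : Set (List S)) :=
  ⟨Unit, inferInstance, ⟨fun _ _ => (), (), Set.univ⟩, by
    ext
    exact iff_of_true trivial trivial⟩

theorem good_map_range {S : Type} {P : Rule S} {W : ℕ → S} {k n : ℕ} (hk : P.bad (W k))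
    (hn : k < n) : Good P W ((List.range n).map W) := by
  refine ⟨fun i b h => ?_, W k, ?_, hk⟩
  · rw [List.getElem?_map, List.getElem?_range] at h
    · simpa using h.symm
    · by_contra hi
      simp [List.getElem?_eq_none (l := List.range n) (i := i) (by simpa using hi)] at h
  · exact List.mem_map_of_mem (List.mem_range.2 hn)

theorem monadicDecomposable_deviationRel {S : Type} {P : Rule S} {W : ℕ → S} :
    MonadicDecomposable (deviationRel P W) ↔ ∀ k, ¬ P.bad (W k) := by
  constructor
  · rintro ⟨m, X, Y, -, hR⟩ k hk
    let u : ℕ → List S := fun n => (List.range (k + 1 + n)).map W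
    have hu : ∀ n, Good P W (u n) := fun n => good_map_range hk (by omega)
    -- There are finitely many sets of indices, so two good prefixes of different lengths lie in the
    -- same left factors.
    obtain ⟨n, n', hne, h⟩ := Finite.exists_ne_map_eq_of_infinite
      fun n => {i : Fin m | u n ∈ X i}
    have h1 : (u n, u n) ∈ deviationRel P W := .inr rfl
    rw [hR, Set.mem_iUnion] at h1
    obtain ⟨i, hi, hi'⟩ := h1
    -- Exchanging the left word stays inside the product, although the new pair has a good first
    -- word and unequal lengths.
    have h2 : (u n', u n) ∈ deviationRel P W := by
      rw [hR, Set.mem_iUnion]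
      have h3 : i ∈ {i : Fin m | u n' ∈ X i} := by
        rw [← h]
        exact hi
      exact ⟨i, h3, hi'⟩
    rcases h2 with h2 | h2
    · exact h2 (hu n')
    · simp only [u, List.length_map, List.length_range] at h2
      omega
  · intro h
    -- No word is good now, so the relation is a single product of full languages.
    refine ⟨1, fun _ => (Set.univ : Set (List S)), fun _ => (Set.univ : Set (List S)),
      fun _ => ⟨isRegular_univ S, isRegular_univ S⟩, ?_⟩
    ext w
    simp only [Set.mem_iUnion]
    refine iff_of_true (.inl ?_) ⟨0, trivial, trivial⟩
    rintro ⟨hp, a, ha, hb⟩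
    obtain ⟨i, hi⟩ := List.mem_iff_getElem?.1 ha
    exact h i (hp i a hi ▸ hb)

/-! ### The automaton for the relation -/

/-- The control states of the two-tape automaton: checking the first word, where the flag tells
whether the second word has ended, comparing the lengths, or reading the rest of the second word. -/
inductive Control (S : Type)
  | check (m : Mode S) (ended : Bool)
  | eq
  | tail

/-- The transitions of the two-tape automaton, with the same conventions as in `ModeStep`. -/
inductive PairStep {S : Type} (P : Rule S) (first last : Bool) (e : S) :
    Control S → Option S → Option S → Control S → Bool → Prop
  | both {m a m' i} (b : S) : ModeStep P first last e m a m' i →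
      PairStep P first last e (.check m false) (some a) (some b) (.check m' false) i
  | drop {m a m' i} : ModeStep P first last e m a m' i →
      PairStep P first last e (.check m false) (some a) none (.check m' true) i
  | left {m a m' i} : ModeStep P first last e m a m' i →
      PairStep P first last e (.check m true) (some a) none (.check m' true) i
  | rest {m : Mode S} (b : S) : first = true → m.Final →
      PairStep P first last e (.check m false) none (some b) .tail false
  | tail (b : S) : first = true → PairStep P first last e .tail none (some b) .tail false
  | eqStart (a b : S) : first = true →
      PairStep P first last e (.check .pos false) (some a) (some b) .eq false
  | eq (a b : S) : first = true → PairStep P first last e .eq (some a) (some b) .eq false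

/-- The accepting control states. -/
inductive Control.Final {S : Type} : Control S → Prop
  | check {m : Mode S} (v : Bool) : m.Final → Control.Final (.check m v)
  | eq : Control.Final .eq
  | tail : Control.Final .tail

variable {S : Type}

theorem ModeStep.inc_of_last {P : Rule S} {first : Bool} {e : S} {m a m' i}
    (h : ModeStep P first true e m a m' i) : i = false := by
  cases h <;> simp_all

/-- This keeps the counter within `0, …, D`. -/
theorem PairStep.inc_of_last {P : Rule S} {first : Bool} {e : S} {p a b q i}
    (h : PairStep P first true e p a b q i) : i = false := by
  cases h with
  | both _ h => exact h.inc_of_last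
  | drop h => exact h.inc_of_last
  | left h => exact h.inc_of_last
  | _ => rfl

/-- Acceptance of a word over pairs from a given control state and value of the counter. -/
def PairAccepts (P : Rule S) (D : ℕ) (W : ℕ → S) :
    Control S → ℕ → List (Option S × Option S) → Prop
  | p, j, [] => j = 0 ∧ p.Final
  | p, j, x :: z => ∃ q i, PairStep P (decide (j = 0)) (decide (j = D)) (W j) p x.1 x.2 q i ∧
      PairAccepts P D W q (if i then j + 1 else 0) z

section PairAccepts

variable {P : Rule S} {D : ℕ} {W : ℕ → S}

theorem pairAccepts_tail {z : List (Option S × Option S)} :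
    PairAccepts P D W .tail 0 z ↔ ∃ v, padPair ([], v) = z := by
  induction z with
  | nil => simpa [PairAccepts, padPair_eq_nil] using Control.Final.tail
  | cons x z ih =>
    constructor
    · rintro ⟨q, i, h, hz⟩
      obtain ⟨x, y⟩ := x
      cases h with
      | tail b h =>
        obtain ⟨v, rfl⟩ := ih.1 (by simpa using hz)
        exact ⟨b :: v, padPair_nil_cons _ _⟩
    · rintro ⟨_ | ⟨b, v⟩, h⟩
      · simp [padPair_nil] at h
      · rw [padPair_nil_cons] at h
        obtain ⟨rfl, rfl⟩ := List.cons_eq_cons.1 h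
        exact ⟨.tail, false, .tail b (by simp), by simpa using ih.2 ⟨v, rfl⟩⟩

theorem pairAccepts_eq {z : List (Option S × Option S)} :
    PairAccepts P D W .eq 0 z ↔ ∃ u v, padPair (u, v) = z ∧ u.length = v.length := by
  induction z with
  | nil => simpa [PairAccepts, padPair_eq_nil] using Control.Final.eq
  | cons x z ih =>
    constructor
    · rintro ⟨q, i, h, hz⟩
      obtain ⟨x, y⟩ := x
      cases h with
      | eq a b h =>
        obtain ⟨u, v, rfl, hl⟩ := ih.1 (by simpa using hz)
        exact ⟨a :: u, b :: v, padPair_cons_cons _ _ _ _, by simpa using hl⟩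
    · rintro ⟨_ | ⟨a, u⟩, _ | ⟨b, v⟩, h, hl⟩
      · simp [padPair_nil] at h
      · simp at hl
      · simp at hl
      · rw [padPair_cons_cons] at h
        obtain ⟨rfl, rfl⟩ := List.cons_eq_cons.1 h
        exact ⟨.eq, false, .eq a b (by simp), by simpa using ih.2 ⟨u, v, rfl, by simpa using hl⟩⟩

theorem pairAccepts_check_true {m : Mode S} {j : ℕ} {z : List (Option S × Option S)} :
    PairAccepts P D W (.check m true) j z ↔ ∃ u, padPair (u, []) = z ∧ ModeAccepts P D W m j u := by
  induction z generalizing m j with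
  | nil =>
    simp only [PairAccepts, padPair_eq_nil, Prod.mk.injEq, and_true, exists_eq_left, ModeAccepts]
    refine and_congr_right fun _ => ⟨?_, .check _⟩
    rintro ⟨⟩
    assumption
  | cons x z ih =>
    constructor
    · rintro ⟨q, i, h, hz⟩
      obtain ⟨x, y⟩ := x
      cases h with
      | @left _ a m' _ h =>
        obtain ⟨u, rfl, hu⟩ := ih.1 hz
        exact ⟨a :: u, padPair_cons_nil _ _, m', i, h, hu⟩
    · rintro ⟨_ | ⟨a, u⟩, h, hu⟩
      · simp [padPair_nil] at h
      · rw [padPair_cons_nil] at h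
        obtain ⟨rfl, rfl⟩ := List.cons_eq_cons.1 h
        obtain ⟨m', i, hs, hu⟩ := hu
        exact ⟨_, i, .left hs, ih.2 ⟨u, rfl, hu⟩⟩

/-- The test for equal lengths can be chosen only in mode `pos` with counter `0`, hence the extra
alternative. The contents of the second word never matter. -/
theorem pairAccepts_check_false {m : Mode S} {j : ℕ} {z : List (Option S × Option S)} :
    PairAccepts P D W (.check m false) j z ↔ ∃ u v, padPair (u, v) = z ∧
      (ModeAccepts P D W m j u ∨ m = .pos ∧ j = 0 ∧ u.length = v.length) := by
  induction z generalizing m j with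
  | nil =>
    constructor
    · rintro ⟨h0, ⟨_, h⟩⟩
      exact ⟨[], [], rfl, .inl ⟨h0, h⟩⟩
    · rintro ⟨u, v, h, h'⟩
      obtain ⟨rfl, rfl⟩ := Prod.mk.injEq _ _ _ _ ▸ padPair_eq_nil.1 h
      rcases h' with ⟨h0, h⟩ | ⟨rfl, h0, -⟩
      · exact ⟨h0, .check _ h⟩
      · exact ⟨h0, .check _ .pos⟩
  | cons x z ih =>
    constructor
    · rintro ⟨q, i, h, hz⟩
      obtain ⟨x, y⟩ := x
      cases h with
      | @both _ a m' _ b h =>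
        obtain ⟨u, v, rfl, hu | ⟨rfl, hi, hl⟩⟩ := ih.1 hz
        · exact ⟨a :: u, b :: v, padPair_cons_cons _ _ _ _, .inl ⟨m', i, h, hu⟩⟩
        -- The only step that stays in mode `pos` increments the counter, so the length test cannot
        -- begin after the first column.
        · cases h with
          | posNext h => simp at hi
      | @drop _ a m' _ h =>
        obtain ⟨u, rfl, hu⟩ := pairAccepts_check_true.1 hz
        exact ⟨a :: u, [], padPair_cons_nil _ _, .inl ⟨m', i, h, hu⟩⟩
      | rest b h hm =>
        obtain ⟨v, rfl⟩ := pairAccepts_tail.1 (by simpa using hz)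
        exact ⟨[], b :: v, padPair_nil_cons _ _, .inl ⟨by simpa using h, hm⟩⟩
      | eqStart a b h =>
        obtain ⟨u, v, rfl, hl⟩ := pairAccepts_eq.1 (by simpa using hz)
        exact ⟨a :: u, b :: v, padPair_cons_cons _ _ _ _, .inr ⟨rfl, by simpa using h, by simpa⟩⟩
    · rintro ⟨_ | ⟨a, u⟩, _ | ⟨b, v⟩, h, hu⟩
      · simp [padPair_nil] at h
      · rw [padPair_nil_cons] at h
        obtain ⟨rfl, rfl⟩ := List.cons_eq_cons.1 h
        obtain ⟨h0, hm⟩ | ⟨-, -, hl⟩ := hu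
        · exact ⟨.tail, false, .rest b (by simpa using h0) hm,
            by simpa using pairAccepts_tail.2 ⟨v, rfl⟩⟩
        · simp at hl
      · rw [padPair_cons_nil] at h
        obtain ⟨rfl, rfl⟩ := List.cons_eq_cons.1 h
        obtain ⟨m', i, hs, hu⟩ | ⟨-, -, hl⟩ := hu
        · exact ⟨_, i, .drop hs, pairAccepts_check_true.2 ⟨u, rfl, hu⟩⟩
        · simp at hl
      · rw [padPair_cons_cons] at h
        obtain ⟨rfl, rfl⟩ := List.cons_eq_cons.1 h
        obtain ⟨m', i, hs, hu⟩ | ⟨rfl, rfl, hl⟩ := hu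
        · exact ⟨_, i, .both b hs, ih.2 ⟨u, v, rfl, .inl hu⟩⟩
        · exact ⟨.eq, false, .eqStart a b (by simp),
            by simpa using pairAccepts_eq.2 ⟨u, v, rfl, by simpa using hl⟩⟩

theorem pairAccepts_start (hW : P.Generates D W) (hD : D ≠ 0) {z : List (Option S × Option S)} :
    PairAccepts P D W (.check .pos false) 0 z ↔ ∃ w ∈ deviationRel P W, padPair w = z := by
  rw [pairAccepts_check_false]
  simp only [modeAccepts_pos_zero_iff_not_good hW hD, true_and, Prod.exists, deviationRel,
    Set.mem_ofPred_eq]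
  simp only [and_comm]

end PairAccepts

/-! ### Numbering of the states, and the automaton with its code -/

theorem finite_mode (S : Type) [Finite S] : Finite (Mode S) := by
  refine Finite.of_injective (β := Fin 9 × Option (S × S))
    (fun m => match m with
      | .pos => (0, none)
      | .posA => (1, none)
      | .posB => (2, none)
      | .clean => (3, none)
      | .run => (4, none)
      | .one a => (5, some (a, a))
      | .two a b => (6, some (a, b))
      | .wait a => (7, some (a, a))
      | .done => (8, none)) ?_
  rintro (_ | _ | _ | _ | _ | _ | _ | _ | _) (_ | _ | _ | _ | _ | _ | _ | _ | _) h <;> simp_all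

theorem finite_control (S : Type) [Finite S] : Finite (Control S) := by
  have := finite_mode S
  refine Finite.of_injective (β := (Mode S × Bool) ⊕ Bool)
    (fun q => match q with
      | .check m v => .inl (m, v)
      | .eq => .inr true
      | .tail => .inr false) ?_
  rintro (_ | _ | _) (_ | _ | _) h <;> simp_all

noncomputable instance (S : Type) [Finite S] : Fintype (Control S) :=
  have := finite_control S
  Fintype.ofFinite _

/-- A transition without the value of the counter: the old control state, two letters, the new
control state, and whether the counter is incremented. -/
abbrev Entry (S : Type) : Type := Control S × Option S × Option S × Control S × Bool

open Classical in
/-- The list of all transitions, given what is known about the counter. -/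
noncomputable def entries {S : Type} [Fintype S] (P : Rule S) (first last : Bool) (e : S) :
    List (Entry S) :=
  (Finset.univ.filter fun t : Entry S =>
    PairStep P first last e t.1 t.2.1 t.2.2.1 t.2.2.2.1 t.2.2.2.2).toList

theorem mem_entries {S : Type} [Fintype S] {P : Rule S} {first last : Bool} {e : S} {t : Entry S} :
    t ∈ entries P first last e ↔ PairStep P first last e t.1 t.2.1 t.2.2.1 t.2.2.2.1 t.2.2.2.2 := by
  simp [entries]

open Classical in
/-- The list of all accepting control states. -/
noncomputable def finals (S : Type) [Fintype S] : List (Control S) :=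
  (Finset.univ.filter fun q : Control S => q.Final).toList

theorem mem_finals {S : Type} [Fintype S] {q : Control S} : q ∈ finals S ↔ q.Final := by
  simp [finals]

/-- The number of control states. -/
noncomputable def controls (S : Type) [Finite S] : ℕ := Fintype.card (Control S)

/-- A numbering of the control states. -/
noncomputable def controlEquiv (S : Type) [Finite S] : Control S ≃ Fin (controls S) :=
  Fintype.equivFin _

/-- The number of a control state. -/
noncomputable def controlNum {S : Type} [Finite S] (q : Control S) : ℕ := controlEquiv S q

/-- The state that consists of a control state and a value of the counter. -/
noncomputable def pairState {S : Type} [Finite S] (D : ℕ) (q : Control S) (j : ℕ) :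
    Fin ((D + 1) * controls S) :=
  finProdFinEquiv (Fin.ofNat (D + 1) j, controlEquiv S q)

/-- The factor and the summand are independent of the counter. In unary, such a number is written by
one fixed word per unit of the counter, followed by a constant. -/
theorem val_pairState {S : Type} [Finite S] {D : ℕ} {q : Control S} {j : ℕ} (hj : j ≤ D) :
    (pairState D q j).val = controls S * j + controlNum q := by
  simp only [pairState, finProdFinEquiv_apply_val, Fin.val_ofNat,
    Nat.mod_eq_of_lt (Nat.lt_succ_of_le hj), controlNum]
  ring

theorem pairState_inj {S : Type} [Finite S] {D : ℕ} {q q' : Control S} {j j' : ℕ} (hj : j ≤ D)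
    (hj' : j' ≤ D) : pairState D q j = pairState D q' j' ↔ q = q' ∧ j = j' := by
  have h : Fin.ofNat (D + 1) j = Fin.ofNat (D + 1) j' ↔ j = j' := by
    simp only [Fin.ext_iff, Fin.val_ofNat, Nat.mod_eq_of_lt (Nat.lt_succ_of_le hj),
      Nat.mod_eq_of_lt (Nat.lt_succ_of_le hj')]
  simp only [pairState, EmbeddingLike.apply_eq_iff_eq, Prod.mk.injEq, h, and_comm]

/-- The transition with the value `j` of the counter. -/
noncomputable def entryAt {S : Type} [Finite S] (D j : ℕ) (t : Entry S) :
    Fin ((D + 1) * controls S) × Option S × Option S × Fin ((D + 1) * controls S) :=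
  (pairState D t.1 j, t.2.1, t.2.2.1, pairState D t.2.2.2.1 (if t.2.2.2.2 then j + 1 else 0))

/-- The automaton for the relation `deviationRel P W`. -/
noncomputable abbrev pairNFA {L : ℕ} (P : Rule (Fin L)) (D : ℕ) (W : ℕ → Fin L) : PairNFA where
  letters := L
  states := (D + 1) * controls (Fin L)
  init := pairState D (.check .pos false) 0
  final := (finals (Fin L)).map fun q => pairState D q 0
  trans := (List.range (D + 1)).flatMap fun j =>
    (entries P (decide (j = 0)) (decide (j = D)) (W j)).map (entryAt D j)

section PairNFA

variable {L : ℕ} {P : Rule (Fin L)} {D : ℕ} {W : ℕ → Fin L}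

theorem mem_trans_pairNFA {q : Control (Fin L)} {j : ℕ} (hj : j ≤ D) {a b : Option (Fin L)}
    {s : Fin ((D + 1) * controls (Fin L))} :
    (pairState D q j, a, b, s) ∈ (pairNFA P D W).trans ↔
      ∃ q' i, PairStep P (decide (j = 0)) (decide (j = D)) (W j) q a b q' i ∧
        s = pairState D q' (if i then j + 1 else 0) := by
  simp only [pairNFA, List.mem_flatMap, List.mem_range, List.mem_map, mem_entries]
  constructor
  · rintro ⟨j', hj', ⟨q₁, a', b', q', i⟩, h, h'⟩
    simp only [entryAt, Prod.mk.injEq] at h'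
    obtain ⟨h1, rfl, rfl, rfl⟩ := h'
    obtain ⟨rfl, rfl⟩ := (pairState_inj (by omega) hj).1 h1
    exact ⟨q', i, h, rfl⟩
  · rintro ⟨q', i, h, rfl⟩
    exact ⟨j, by omega, (q, a, b, q', i), h, rfl⟩

/-- The reduction modulo `D + 1` in `pairState` therefore never takes effect. -/
theorem PairStep.next_le {j : ℕ} {e : Fin L} {q a b q' i} (hj : j ≤ D)
    (h : PairStep P (decide (j = 0)) (decide (j = D)) e q a b q' i) :
    (if i then j + 1 else 0) ≤ D := by
  by_cases hD : j = D
  · rw [decide_eq_true hD] at h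
    simp [h.inc_of_last]
  · split <;> omega

theorem mem_acceptsFrom_pairNFA {q : Control (Fin L)} {j : ℕ} (hj : j ≤ D)
    {z : List (Option (Fin L) × Option (Fin L))} :
    z ∈ (pairNFA P D W).toNFA.acceptsFrom {pairState D q j} ↔ PairAccepts P D W q j z := by
  induction z generalizing q j with
  | nil =>
    rw [NFA.nil_mem_acceptsFrom]
    simp only [Set.mem_singleton_iff, exists_eq_left, PairNFA.toNFA, PairAccepts]
    constructor
    · intro h
      obtain ⟨q', hq', h⟩ := List.mem_map.1 h
      obtain ⟨rfl, rfl⟩ := (pairState_inj (Nat.zero_le _) hj).1 h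
      exact ⟨rfl, mem_finals.1 hq'⟩
    · rintro ⟨rfl, h⟩
      exact List.mem_map.2 ⟨q, mem_finals.2 h, rfl⟩
  | cons x z ih =>
    obtain ⟨a, b⟩ := x
    rw [NFA.cons_mem_acceptsFrom, NFA.stepSet_singleton, NFA.mem_acceptsFrom]
    -- Splitting the set of successors into single states makes the induction hypothesis applicable.
    simp only [NFA.mem_evalFrom_iff_exists (S := (pairNFA P D W).toNFA.step _ _)]
    constructor
    · rintro ⟨s, hs, t, ht, h⟩
      obtain ⟨q', i, hstep, rfl⟩ := (mem_trans_pairNFA hj).1 ht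
      exact ⟨q', i, hstep, (ih (hstep.next_le hj)).1 ⟨s, hs, h⟩⟩
    · rintro ⟨q', i, hstep, hz⟩
      obtain ⟨s, hs, h⟩ := (ih (hstep.next_le hj)).2 hz
      exact ⟨s, hs, _, (mem_trans_pairNFA hj).2 ⟨q', i, hstep, rfl⟩, h⟩

theorem pairNFA_defines (hW : P.Generates D W) (hD : D ≠ 0) :
    (pairNFA P D W).Defines (deviationRel P W) := fun _ =>
  (mem_acceptsFrom_pairNFA (Nat.zero_le D)).trans (pairAccepts_start hW hD)

theorem yes_pairNFA (hW : P.Generates D W) (hD : D ≠ 0) :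
    (∃ R, (pairNFA P D W).Defines R ∧ MonadicDecomposable R) ↔ ∀ k, ¬ P.bad (W k) := by
  rw [← monadicDecomposable_deviationRel]
  constructor
  · rintro ⟨R, hR, h⟩
    rwa [hR.unique (pairNFA_defines hW hD)] at h
  · exact fun h => ⟨_, pairNFA_defines hW hD, h⟩

/-- The code of the transition with the value `j` of the counter. -/
noncomputable def codeEntry (j : ℕ) (t : Entry (Fin L)) : List PairNFA.Code :=
  PairNFA.codeNat (controls (Fin L) * j + controlNum t.1) ++ (PairNFA.codeLetter t.2.1 ++
    (PairNFA.codeLetter t.2.2.1 ++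
      PairNFA.codeNat (controls (Fin L) * (if t.2.2.2.2 then j + 1 else 0) + controlNum t.2.2.2.1)))

/-- This is the form in which the code is written: only plain numbers occur, and the transitions are
grouped by the value of the counter. -/
theorem encode_pairNFA : (pairNFA P D W).encode =
    PairNFA.codeNat L ++ (PairNFA.codeNat ((D + 1) * controls (Fin L)) ++
      (PairNFA.codeNat (controlNum (.check .pos false : Control (Fin L))) ++
        ((finals (Fin L)).flatMap (fun q => PairNFA.codeNat (controlNum q)) ++
          (.bar :: (List.range (D + 1)).flatMap fun j =>
            (entries P (decide (j = 0)) (decide (j = D)) (W j)).flatMap (codeEntry j))))) := by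
  have h0 : ∀ q : Control (Fin L), PairNFA.codeState (pairState D q 0) =
      PairNFA.codeNat (controlNum q) := fun q => by
    rw [PairNFA.codeState, val_pairState (Nat.zero_le _), Nat.mul_zero, Nat.zero_add]
  have h1 : ∀ j ∈ List.range (D + 1), (entries P (decide (j = 0)) (decide (j = D)) (W j)).flatMap
      (codeEntry j) = (entries P (decide (j = 0)) (decide (j = D)) (W j)).flatMap
        fun t => PairNFA.codeTrans (entryAt D j t) := by
    intro j hj
    have hj : j ≤ D := by simpa [Nat.lt_succ_iff] using hj
    rw [List.flatMap_def, List.flatMap_def]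
    congr 1
    refine List.map_congr_left fun t ht => ?_
    rw [codeEntry, PairNFA.codeTrans, entryAt, PairNFA.codeState, PairNFA.codeState,
      val_pairState hj, val_pairState ((mem_entries.1 ht).next_le hj)]
  have h2 := List.map_congr_left h1
  rw [PairNFA.encode]
  simp only [pairNFA, List.flatMap_map, h0, List.flatMap_assoc]
  rw [List.flatMap_def (l := List.range _), List.flatMap_def (l := List.range _), h2]

end PairNFA

/-! ### The word of all configurations of a Turing machine -/

namespace TM

variable {A : Type} (M : TM A)

/-- The letters of the word of all configurations: a separator, or the symbol in a cell together
with the state if the cell is scanned. -/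
abbrev Letter : Type := Option (Option M.State × Option (A ⊕ M.Aux))

/-- The letter number `i` of a configuration, where the letter number `0` is the separator. -/
def letterAt (c : M.Config) : ℕ → M.Letter
  | 0 => none
  | i + 1 => some (if c.head = i then some c.state else none, c.tape i)

open Classical in
/-- The new state if the given letter is scanned and the head makes the move `d`. -/
noncomputable def moved (d : Move) : M.Letter → Option M.State
  | some (some q, b) =>
    match M.next q b with
    | none => if d = .stay then some q else none
    | some (q', _, d') => if d' = d then some q' else none
  | _ => none

/-- The symbol in a cell after one step. -/
def written : Option M.State × Option (A ⊕ M.Aux) → Option (A ⊕ M.Aux)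
  | (some q, b) =>
    match M.next q b with
    | none => b
    | some (_, s, _) => s
  | (none, b) => b

/-- The letter that replaces `c` after one step, if `c` stands between `l` and `r`. -/
noncomputable def localRule (l c r : M.Letter) : M.Letter :=
  match c with
  | none => none
  | some x => some (M.moved .right l <|> M.moved .stay c <|> M.moved .left r <|>
      (match l with
        | none => M.moved .left c
        | some _ => none), M.written x)

open Classical in
/-- The new state of a configuration if the head makes the move `d`. -/
noncomputable def newState (c : M.Config) (d : Move) : Option M.State :=
  match M.next c.state (c.tape c.head) with
  | none => if d = .stay then some c.state else none
  | some (q', _, d') => if d' = d then some q' else none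

theorem moved_letterAt_succ (c : M.Config) (d : Move) (i : ℕ) :
    M.moved d (M.letterAt c (i + 1)) = if c.head = i then M.newState c d else none := by
  by_cases h : c.head = i
  · subst h
    simp [letterAt, moved, newState]
  · simp [letterAt, moved, h]

theorem written_eq (c : M.Config) (i : ℕ) :
    M.written (if c.head = i then some c.state else none, c.tape i) = (M.step c).tape i := by
  by_cases h : c.head = i
  · subst h
    rcases hn : M.next c.state (c.tape c.head) with _ | ⟨q, s, d⟩ <;> simp [written, step, hn]
  · rcases hn : M.next c.state (c.tape c.head) with _ | ⟨q, s, d⟩ <;>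
      simp [written, step, hn, h, Function.update_of_ne (Ne.symm h)]

/-- The head arrives at a cell from its left, from itself, from its right, or by bouncing off the
left end. The alternative for `r` covers the last cell of a padded configuration, whose right
neighbour is the next separator; nothing is lost if the head is not beyond that cell. -/
theorem letterAt_step (c : M.Config) {k : ℕ} {r : M.Letter}
    (hr : r = M.letterAt c (k + 2) ∨ r = none ∧ c.head ≠ k + 1) :
    M.letterAt (M.step c) (k + 1) = M.localRule (M.letterAt c k) (M.letterAt c (k + 1)) r := by
  have hr : M.moved .left r = if c.head = k + 1 then M.newState c .left else none := by
    rcases hr with rfl | ⟨rfl, h⟩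
    · exact M.moved_letterAt_succ c _ _
    · simp [moved, h]
  have hc : M.localRule (M.letterAt c k) (M.letterAt c (k + 1)) r =
      some (M.moved .right (M.letterAt c k) <|> M.moved .stay (M.letterAt c (k + 1)) <|>
        M.moved .left r <|> (match M.letterAt c k with
          | none => M.moved .left (M.letterAt c (k + 1))
          | some _ => none), (M.step c).tape k) := by
    rw [← written_eq]
    rfl
  rw [hc, hr, moved_letterAt_succ, moved_letterAt_succ, letterAt]
  congr 2
  cases k with
  -- Cell `0`: the left neighbour is the separator, and a head that moves left stays.
  | zero =>
    rcases hn : M.next c.state (c.tape c.head) with _ | ⟨q, s, d⟩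
    · simp only [step, hn, newState, letterAt, moved]
      split_ifs <;> simp_all
    · simp only [step, hn, newState, letterAt, moved]
      by_cases h0 : c.head = 0 <;> by_cases h1 : c.head = 1 <;> cases d <;>
        (simp [Move.apply, h0, h1, Nat.sub_eq_zero_iff_le]; try omega)
  | succ k =>
    rw [moved_letterAt_succ]
    rcases hn : M.next c.state (c.tape c.head) with _ | ⟨q, s, d⟩
    · simp only [step, hn, newState, letterAt]
      split_ifs <;> first | omega | simp_all
    · simp only [step, hn, newState, letterAt]
      cases d <;> simp only [Move.apply] <;> split_ifs <;> first | omega | simp_all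

/-- The word of the configurations on input `x`, each of which takes `s` letters. -/
def word (x : List A) (s k : ℕ) : M.Letter := M.letterAt (M.conf x (k / s)) (k % s)

theorem conf_succ (x : List A) (t : ℕ) : M.conf x (t + 1) = M.step (M.conf x t) :=
  Function.iterate_succ_apply' _ _ _

theorem word_next {x : List A} {s : ℕ} (hs : 2 ≤ s) (hM : ∀ t, (M.conf x t).head + 2 < s) (i : ℕ) :
    M.word x s (i + (s + 1)) =
      M.localRule (M.word x s i) (M.word x s (i + 1)) (M.word x s (i + 2)) := by
  -- The window is located by its middle letter, since `i + (s + 1)` is the same place in the next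
  -- configuration. If the middle letter is a separator, its neighbours do not matter.
  obtain ⟨t, k, hk, hi⟩ : ∃ t k, k < s ∧ i + 1 = s * t + k :=
    ⟨(i + 1) / s, (i + 1) % s, Nat.mod_lt _ (by omega), (Nat.div_add_mod _ _).symm⟩
  have hw : ∀ t k, k < s → M.word x s (s * t + k) = M.letterAt (M.conf x t) k := by
    intro t k hk
    rw [word, Nat.mul_add_div (by omega), Nat.div_eq_of_lt hk, Nat.mul_add_mod,
      Nat.mod_eq_of_lt hk, Nat.add_zero]
  rw [show i + (s + 1) = s * (t + 1) + k by rw [Nat.mul_add]; omega, hi, hw _ _ hk, hw _ _ hk]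
  cases k with
  | zero => rfl
  | succ k =>
    rw [show i = s * t + k by omega, hw _ _ (by omega), conf_succ]
    apply M.letterAt_step
    rcases Nat.lt_or_ge (k + 2) s with h | h
    · exact .inl (by rw [Nat.add_assoc, hw _ _ h])
    · refine .inr ⟨?_, ?_⟩
      · rw [show s * t + k + 2 = s * (t + 1) + 0 by rw [Nat.mul_add]; omega, hw _ _ (by omega)]
        rfl
      · have := hM t
        omega

/-! ### Rejection seen in the word of configurations -/

/-- A letter that shows that the machine has halted without accepting. -/
def Rejecting : M.Letter → Prop
  | some (some q, b) => M.next q b = none ∧ q ∉ M.accept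
  | _ => False

theorem rejecting_letterAt (c : M.Config) (k : ℕ) :
    M.Rejecting (M.letterAt c k) ↔ k = c.head + 1 ∧ M.Halted c ∧ c.state ∉ M.accept := by
  rcases k with _ | i
  · simp [letterAt, Rejecting]
  · by_cases h : c.head = i
    · subst h
      simp [letterAt, Rejecting, Halted]
    · simp [letterAt, Rejecting, h, Ne.symm h]

theorem rejecting_word {x : List A} {s : ℕ} (hM : ∀ t, (M.conf x t).head + 2 < s) :
    (∃ k, M.Rejecting (M.word x s k)) ↔
      ∃ t, M.Halted (M.conf x t) ∧ (M.conf x t).state ∉ M.accept := by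
  simp only [word, rejecting_letterAt]
  constructor
  · rintro ⟨k, -, hk⟩
    exact ⟨_, hk⟩
  · rintro ⟨t, ht⟩
    have hs := hM t
    have h1 : (s * t + ((M.conf x t).head + 1)) / s = t := by
      rw [Nat.mul_add_div (by omega), Nat.div_eq_of_lt (by omega), Nat.add_zero]
    refine ⟨s * t + ((M.conf x t).head + 1), ?_⟩
    rw [h1, Nat.mul_add_mod, Nat.mod_eq_of_lt (by omega)]
    exact ⟨rfl, ht⟩

theorem conf_of_halted {x : List A} {t : ℕ} (h : M.Halted (M.conf x t)) (k : ℕ) :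
    M.conf x (t + k) = M.conf x t := by
  induction k with
  | zero => rfl
  | succ k ih =>
    have h' : M.next (M.conf x t).state ((M.conf x t).tape (M.conf x t).head) = none := h
    rw [← Nat.add_assoc, conf_succ, ih, step, h']

/-- A halted configuration never changes, so any two halting times give the same verdict. -/
theorem mem_iff_not_rejecting {L : Language A} (hM : M.Decides L) (x : List A) :
    x ∈ L ↔ ¬ ∃ t, M.Halted (M.conf x t) ∧ (M.conf x t).state ∉ M.accept := by
  obtain ⟨t, ht, hx⟩ := hM x
  rw [← hx]
  constructor
  · rintro h ⟨t', ht', h'⟩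
    rcases Nat.le_total t t' with hle | hle
    · obtain ⟨k, rfl⟩ := Nat.exists_eq_add_of_le hle
      rw [M.conf_of_halted ht] at h'
      exact h' h
    · obtain ⟨k, rfl⟩ := Nat.exists_eq_add_of_le hle
      rw [M.conf_of_halted ht'] at h
      exact h' h
  · intro h
    by_contra h'
    exact h ⟨t, ht, h'⟩

/-- The first configuration on input `x`, for words in which it is followed by another one. -/
theorem word_of_lt {x : List A} {s k : ℕ} (hk : k < s) :
    M.word x s k = M.letterAt (M.init x) k := by
  rw [word, Nat.div_eq_of_lt hk, Nat.mod_eq_of_lt hk]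
  rfl

theorem word_self {x : List A} {s : ℕ} : M.word x s s = none := by
  rw [word, Nat.mod_self]
  rfl

end TM

/-! ### Fragments of transducers -/

/-- Everything but the state in a configuration of a transducer. -/
@[ext]
structure Memory (B C : Type) (k : ℕ) where
  inputHead : ℕ
  heads : Fin k → ℕ
  work : Fin k → ℕ → C
  output : List B

namespace Memory

variable {A B C : Type} {k : ℕ}

/-- The scanned input symbol. -/
def sym (x : List A) (m : Memory B C k) : InputSym A := Transducer.readInput x m.inputHead

/-- The scanned work symbols. -/
def scan (m : Memory B C k) : Fin k → C := fun i => m.work i (m.heads i)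

/-- The effect of a transition. -/
def act (x : List A) (m : Memory B C k) (d : Move) (w : Fin k → C × Move) (o : Option B) :
    Memory B C k where
  inputHead := min (d.apply m.inputHead) (x.length + 1)
  heads := fun i => (w i).2.apply (m.heads i)
  work := fun i => Function.update (m.work i) (m.heads i) (w i).1
  output := m.output ++ o.toList

/-- The input head is on the input tape, and the other heads are in the first `b` cells. -/
def Ok (x : List A) (b : ℕ) (m : Memory B C k) : Prop :=
  m.inputHead ≤ x.length + 1 ∧ ∀ i, m.heads i < b

end Memory

/-- The actions on the work tapes that change nothing. -/
def idle {C : Type} {k : ℕ} (v : Fin k → C) : Fin k → C × Move := fun i => (v i, .stay)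

/-- A transducer that may be started with any contents of its tapes. -/
structure Frag (A B C : Type) (k : ℕ) where
  State : Type
  [stateFintype : Fintype State]
  start : State
  next : State → InputSym A → (Fin k → C) → Option (State × Move × (Fin k → C × Move) × Option B)

namespace Frag

attribute [instance] Frag.stateFintype

variable {A B C : Type} {k : ℕ}

/-- One step on input `x`, after which the heads are in the first `b` cells. -/
def Step (F : Frag A B C k) (x : List A) (b : ℕ) (c c' : F.State × Memory B C k) : Prop :=
  ∃ d w o, F.next c.1 (c.2.sym x) c.2.scan = some (c'.1, d, w, o) ∧ c'.2 = c.2.act x d w o ∧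
    ∀ i, c'.2.heads i < b

/-- Started in `m`, the fragment halts in `m'`, and all heads are always in the first `b` cells. -/
def Exec (F : Frag A B C k) (x : List A) (b : ℕ) (m m' : Memory B C k) : Prop :=
  m.Ok x b ∧ ∃ q, Relation.ReflTransGen (F.Step x b) (F.start, m) (q, m') ∧
    F.next q (m'.sym x) m'.scan = none

theorem Step.ok {F : Frag A B C k} {x : List A} {b : ℕ} {c c' : F.State × Memory B C k}
    (h : F.Step x b c c') : c'.2.Ok x b := by
  obtain ⟨d, w, o, -, h, hb⟩ := h
  exact ⟨by rw [h]; exact min_le_right _ _, hb⟩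

theorem ok_of_reflTransGen {F : Frag A B C k} {x : List A} {b : ℕ} {c c' : F.State × Memory B C k}
    (h : Relation.ReflTransGen (F.Step x b) c c') (hc : c.2.Ok x b) : c'.2.Ok x b := by
  cases h with
  | refl => exact hc
  | tail _ h => exact h.ok

theorem Exec.ok {F : Frag A B C k} {x : List A} {b : ℕ} {m m' : Memory B C k}
    (h : F.Exec x b m m') : m'.Ok x b := by
  obtain ⟨hm, q, h, -⟩ := h
  exact ok_of_reflTransGen h hm

theorem act_idle {x : List A} {b : ℕ} {m : Memory B C k} (hm : m.Ok x b) :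
    m.act x .stay (idle m.scan) none = m := by
  obtain ⟨h1, h2⟩ := hm
  ext
  · simpa [Memory.act, Move.apply] using h1
  · simp [Memory.act, Move.apply, idle]
  · simp [Memory.act, idle, Memory.scan]
  · simp [Memory.act]

theorem step_idle {F : Frag A B C k} {x : List A} {b : ℕ} {m : Memory B C k} (hm : m.Ok x b)
    {q q' : F.State} (h : F.next q (m.sym x) m.scan = some (q', .stay, idle m.scan, none)) :
    F.Step x b (q, m) (q', m) :=
  ⟨_, _, _, h, (act_idle hm).symm, hm.2⟩

/-- The fragment with one transition, which moves the input head and writes at most one symbol to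
the output. -/
def single (d : Move) (o : Option B) : Frag A B C k where
  State := Bool
  start := false
  next := fun q _ v => if q then none else some (true, d, idle v, o)

theorem exec_single {x : List A} {b : ℕ} {m : Memory B C k} (hm : m.Ok x b) (d : Move)
    (o : Option B) : (single d o).Exec x b m
      { m with inputHead := min (d.apply m.inputHead) (x.length + 1)
               output := m.output ++ o.toList } := by
  refine ⟨hm, true, .single ⟨d, idle m.scan, o, rfl, ?_, hm.2⟩, rfl⟩
  ext <;> simp [Memory.act, Move.apply, idle, Memory.scan]

/-- The fragment that does nothing. -/
def skip : Frag A B C k where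
  State := Unit
  start := ()
  next := fun _ _ _ => none

theorem exec_skip {x : List A} {b : ℕ} {m : Memory B C k} (hm : m.Ok x b) :
    (skip : Frag A B C k).Exec x b m m :=
  ⟨hm, (), .refl, rfl⟩

/-- One fragment after the other. -/
def seq (F G : Frag A B C k) : Frag A B C k where
  State := F.State ⊕ G.State
  start := .inl F.start
  next := fun q s v =>
    match q with
    | .inl q =>
      match F.next q s v with
      | some (q', r) => some (.inl q', r)
      | none => some (.inr G.start, .stay, idle v, none)
    | .inr q => (G.next q s v).map fun r => (.inr r.1, r.2)

/-- The runs are embedded into the two summands of the state space and joined by an idle transition,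
taken where the first fragment halts. -/
theorem exec_seq {F G : Frag A B C k} {x : List A} {b : ℕ} {m m₁ m₂ : Memory B C k}
    (hF : F.Exec x b m m₁) (hG : G.Exec x b m₁ m₂) : (F.seq G).Exec x b m m₂ := by
  have hok := hF.ok
  obtain ⟨hm, q, hq, hn⟩ := hF
  obtain ⟨-, q', hq', hn'⟩ := hG
  refine ⟨hm, .inr q', ?_, by simp [seq, hn']⟩
  have h1 : Relation.ReflTransGen ((F.seq G).Step x b) (.inl F.start, m) (.inl q, m₁) := by
    refine hq.lift (p := (F.seq G).Step x b)
      (fun c => (.inl c.1, c.2)) ?_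
    rintro c c' ⟨d, w, o, h, h'⟩
    exact ⟨d, w, o, by simp [seq, h], h'⟩
  have h2 : Relation.ReflTransGen ((F.seq G).Step x b) (.inr G.start, m₁) (.inr q', m₂) := by
    refine hq'.lift (p := (F.seq G).Step x b)
      (fun c => (.inr c.1, c.2)) ?_
    rintro c c' ⟨d, w, o, h, h'⟩
    exact ⟨d, w, o, by simp [seq, h], h'⟩
  exact (h1.tail (step_idle hok (by simp [seq, hn]))).trans h2

open Classical in
/-- Repetition of a fragment while a condition on the scanned symbols holds. -/
noncomputable def loop (p : InputSym A → (Fin k → C) → Prop) (F : Frag A B C k) :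
    Frag A B C k where
  State := Option F.State
  start := none
  next := fun q s v =>
    match q with
    | none => if p s v then some (some F.start, .stay, idle v, none) else none
    | some q =>
      match F.next q s v with
      | some (q', r) => some (some q', r)
      | none => some (none, .stay, idle v, none)

/-- The sequence `m` gives the memory at the start of each round and plays the role of a loop
invariant. -/
theorem exec_loop {p : InputSym A → (Fin k → C) → Prop} {F : Frag A B C k} {x : List A} {b : ℕ}
    {m : ℕ → Memory B C k} {n : ℕ} (hF : ∀ j < n, F.Exec x b (m j) (m (j + 1)))
    (hp : ∀ j < n, p ((m j).sym x) (m j).scan) (hn : ¬ p ((m n).sym x) (m n).scan)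
    (hok : (m 0).Ok x b) : (F.loop p).Exec x b (m 0) (m n) := by
  refine ⟨hok, none, ?_, by simp [loop, hn]⟩
  have key : ∀ j ≤ n, Relation.ReflTransGen ((F.loop p).Step x b) (none, m 0) (none, m j) := by
    intro j hj
    induction j with
    | zero => exact .refl
    | succ j ih =>
      have hE := hF j hj
      have hok := hE.ok
      obtain ⟨hm, q, hq, hn⟩ := hE
      have h1 : Relation.ReflTransGen ((F.loop p).Step x b) (some F.start, m j)
          (some q, m (j + 1)) := by
        refine hq.lift (p := (F.loop p).Step x b)
          (fun c => (some c.1, c.2)) ?_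
        rintro c c' ⟨d, w, o, h, h'⟩
        exact ⟨d, w, o, by simp [loop, h], h'⟩
      refine (((ih (by omega)).tail (step_idle hm ?_)).trans h1).tail (step_idle hok ?_)
      · simp [loop, hp j hj]
      · simp [loop, hn]
  exact key n le_rfl

/-- A fragment that depends on the scanned input symbol. -/
def branch [Fintype (InputSym A)] (F : InputSym A → Frag A B C k) : Frag A B C k where
  State := Option (Σ s, (F s).State)
  start := none
  next := fun q s v =>
    match q with
    | none => some (some ⟨s, (F s).start⟩, .stay, idle v, none)
    | some ⟨t, q⟩ => ((F t).next q s v).map fun r => (some ⟨t, r.1⟩, r.2)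

theorem exec_branch [Fintype (InputSym A)] {F : InputSym A → Frag A B C k} {x : List A} {b : ℕ}
    {m m' : Memory B C k} (h : (F (m.sym x)).Exec x b m m') : (branch F).Exec x b m m' := by
  obtain ⟨hm, q, hq, hn⟩ := h
  refine ⟨hm, some ⟨_, q⟩, ?_, by simp [branch, hn]⟩
  have h1 : Relation.ReflTransGen ((branch F).Step x b) (some ⟨_, (F (m.sym x)).start⟩, m)
      (some ⟨_, q⟩, m') := by
    refine hq.lift (p := (branch F).Step x b)
      (fun c => (some ⟨m.sym x, c.1⟩, c.2)) ?_
    rintro c c' ⟨d, w, o, h, h'⟩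
    exact ⟨d, w, o, by simp [branch, h], h'⟩
  exact .head (step_idle hm rfl) h1

/-! ### From fragments to logarithmic space transducers -/

/-- The fragment as a transducer. -/
def toTransducer [Fintype C] (F : Frag A B C k) (blank : C) : Transducer A B where
  State := F.State
  Work := C
  blank := blank
  tapes := k
  start := F.start
  next := F.next

/-- The initial contents of the tapes. -/
def _root_.MonDec.Memory.initial (blank : C) : Memory B C k where
  inputHead := 0
  heads := fun _ => 0
  work := fun _ _ => blank
  output := []

section toTransducer

variable [Fintype C] {F : Frag A B C k} {blank : C}

/-- The configuration of the transducer that is given by a state and the contents of the tapes. -/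
def config (F : Frag A B C k) (blank : C) (c : F.State × Memory B C k) :
    (F.toTransducer blank).Config where
  state := c.1
  inputHead := c.2.inputHead
  heads := c.2.heads
  work := c.2.work
  output := c.2.output

theorem step_config {x : List A} {b : ℕ} {c c' : F.State × Memory B C k} (h : F.Step x b c c') :
    (F.toTransducer blank).step x (F.config blank c) = F.config blank c' := by
  obtain ⟨d, w, o, h, h', -⟩ := h
  have : (F.toTransducer blank).action x (F.config blank c) = some (c'.1, d, w, o) := h
  rw [Transducer.step, this]
  simp only [config, h']
  rfl

theorem step_of_halted {T : Transducer A B} {x : List A} {c : T.Config} (h : T.Halted x c) :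
    T.step x c = c := by
  have h : T.action x c = none := h
  rw [Transducer.step, h]

/-- The transducer is deterministic and a halted configuration is repeated forever, so a bound along
one halting run holds at all times. -/
theorem halts_of_reflTransGen {x : List A} {b : ℕ} {c c' : F.State × Memory B C k}
    (h : Relation.ReflTransGen (F.Step x b) c c') (hc : c.2.Ok x b)
    (hn : F.next c'.1 (c'.2.sym x) c'.2.scan = none) :
    (∃ t, ((F.toTransducer blank).step x)^[t] (F.config blank c) = F.config blank c') ∧
      ∀ t i, (((F.toTransducer blank).step x)^[t] (F.config blank c)).heads i < b := by
  induction h using Relation.ReflTransGen.head_induction_on with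
  | refl =>
    refine ⟨⟨0, rfl⟩, fun t i => ?_⟩
    have : (F.toTransducer blank).Halted x (F.config blank c') := hn
    rw [Function.iterate_fixed (step_of_halted this)]
    exact hc.2 i
  | head h h' ih =>
    obtain ⟨⟨t, ht⟩, hb⟩ := ih h.ok
    refine ⟨⟨t + 1, by rw [Function.iterate_succ_apply, step_config h, ht]⟩, fun t i => ?_⟩
    cases t with
    | zero => exact hc.2 i
    | succ t =>
      rw [Function.iterate_succ_apply, step_config h]
      exact hb t i

theorem logspaceComputable_of_exec {f : List A → List B} {c : ℕ}
    (h : ∀ x, ∃ m, F.Exec x (c * (Nat.log 2 x.length + 1)) (.initial blank) m ∧ m.output = f x) :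
    LogspaceComputable f := by
  refine ⟨F.toTransducer blank, c, fun x => ?_, fun x t i => ?_⟩
  · obtain ⟨m, ⟨hok, q, hq, hn⟩, hm⟩ := h x
    obtain ⟨t, ht⟩ := (halts_of_reflTransGen (blank := blank) hq hok hn).1
    have ht : (F.toTransducer blank).conf x t = _ := ht
    refine ⟨t, ?_, ?_⟩
    · rw [ht]
      exact hn
    · rw [ht]
      exact hm
  · obtain ⟨m, ⟨hok, q, hq, hn⟩, hm⟩ := h x
    exact (halts_of_reflTransGen (blank := blank) hq hok hn).2 t i

end toTransducer

end Frag

/-! ### Registers on work tapes -/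

/-- The successor of a number in bijective base two, where `false` and `true` are the digits `1` and
`2`, and the least significant digit comes first. -/
def succDigits : List Bool → List Bool
  | [] => [false]
  | false :: l => true :: l
  | true :: l => false :: succDigits l

/-- The digits of a number in bijective base two. -/
def digits : ℕ → List Bool
  | 0 => []
  | n + 1 => succDigits (digits n)

/-- The number with the given digits in bijective base two. -/
def ofDigits : List Bool → ℕ
  | [] => 0
  | false :: l => 2 * ofDigits l + 1
  | true :: l => 2 * ofDigits l + 2

theorem ofDigits_succDigits (l : List Bool) : ofDigits (succDigits l) = ofDigits l + 1 := by
  induction l with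
  | nil => rfl
  | cons a l ih => cases a <;> simp only [succDigits, ofDigits, ih]; ring

theorem ofDigits_digits (n : ℕ) : ofDigits (digits n) = n := by
  induction n with
  | zero => rfl
  | succ n ih => rw [digits, ofDigits_succDigits, ih]

/-- Every digit is at least `1`, so the least value with `n` digits is `2 ^ n - 1`. This yields the
logarithmic length of registers. -/
theorem two_pow_length_le (l : List Bool) : 2 ^ l.length ≤ ofDigits l + 1 := by
  induction l with
  | nil => simp [ofDigits]
  | cons a l ih => cases a <;> simp only [ofDigits, List.length_cons, pow_succ] <;> omega

theorem two_pow_length_digits_le (n : ℕ) : 2 ^ (digits n).length ≤ n + 1 := by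
  simpa only [ofDigits_digits] using two_pow_length_le (digits n)

theorem succDigits_ne_nil (l : List Bool) : succDigits l ≠ [] := by
  rcases l with _ | ⟨_ | _, l⟩ <;> simp [succDigits]

theorem length_le_length_succDigits (l : List Bool) : l.length ≤ (succDigits l).length := by
  induction l with
  | nil => simp
  | cons a l ih => cases a <;> simp [succDigits, ih]

/-- The contents of a work tape that holds the given digits from cell `1` on. -/
def tapeOf (l : List Bool) : ℕ → Option Bool
  | 0 => none
  | i + 1 => l[i]?

theorem update_tapeOf (p l : List Bool) (a b : Bool) :
    Function.update (tapeOf (p ++ a :: l)) (p.length + 1) (some b) = tapeOf (p ++ b :: l) := by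
  funext i
  rcases i with _ | i
  · simp [tapeOf]
  · rcases Nat.lt_trichotomy i p.length with h | rfl | h
    · rw [Function.update_of_ne (by omega)]
      simp [tapeOf, List.getElem?_append_left h]
    · simp [tapeOf]
    · obtain ⟨j, rfl⟩ : ∃ j, i = p.length + 1 + j := ⟨i - (p.length + 1), by omega⟩
      rw [Function.update_of_ne (by omega)]
      simp [tapeOf, List.getElem?_append_right, Nat.add_assoc, Nat.add_comm 1]

theorem update_tapeOf_append (p : List Bool) (b : Bool) :
    Function.update (tapeOf p) (p.length + 1) (some b) = tapeOf (p ++ [b]) := by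
  funext i
  rcases i with _ | i
  · simp [tapeOf]
  · rcases Nat.lt_trichotomy i p.length with h | rfl | h
    · rw [Function.update_of_ne (by omega)]
      simp [tapeOf, List.getElem?_append_left h]
    · simp [tapeOf]
    · rw [Function.update_of_ne (by omega)]
      simp only [tapeOf]
      rw [List.getElem?_eq_none (by omega), List.getElem?_eq_none (by simp; omega)]

theorem update_tapeOf_none (p : List Bool) (b : Bool) :
    Function.update (tapeOf (p ++ [b])) (p.length + 1) none = tapeOf p := by
  rw [← update_tapeOf_append, Function.update_idem, Function.update_eq_self_iff]
  simp [tapeOf]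

/-! ### Adding and subtracting one on a work tape -/

namespace Frag

variable {A B : Type} {k : ℕ}

/-- The memory `m` in which one work tape and its head are replaced. -/
def _root_.MonDec.Memory.setTape {C : Type} (m : Memory B C k) (i : Fin k) (t : ℕ → C) (h : ℕ) :
    Memory B C k :=
  { m with heads := Function.update m.heads i h, work := Function.update m.work i t }

/-- A fragment that uses one work tape only. -/
def oneTape {C : Type} (i : Fin k) (Q : Type) [Fintype Q] (start : Q)
    (f : Q → C → Option (Q × C × Move)) : Frag A B C k where
  State := Q
  start := start
  next := fun q _ v => (f q (v i)).map fun r => (r.1, .stay, Function.update (idle v) i r.2, none)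

theorem oneTape_step {C : Type} {i : Fin k} {Q : Type} [Fintype Q] {start : Q}
    {f : Q → C → Option (Q × C × Move)} {x : List A} {b : ℕ} {m : Memory B C k} (hm : m.Ok x b)
    {q q' : Q} {t t' : ℕ → C} {h h' : ℕ} {s : C} {d : Move} (hf : f q (t h) = some (q', s, d))
    (ht : Function.update t h s = t') (hd : d.apply h = h') (hb : h' < b) :
    (oneTape i Q start f : Frag A B C k).Step x b (q, m.setTape i t h)
      (q', m.setTape i t' h') := by
  subst ht hd
  have hs : (m.setTape i t h).scan i = t h := by simp [Memory.setTape, Memory.scan]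
  refine ⟨.stay, Function.update (idle (m.setTape i t h).scan) i (s, d), none,
    by simp only [oneTape, hs, hf, Option.map_some], ?_, ?_⟩
  · ext j
    · simpa [Memory.act, Move.apply, Memory.setTape] using hm.1
    · by_cases hj : j = i
      · subst hj
        simp [Memory.act, Memory.setTape]
      · simp [Memory.act, Memory.setTape, hj, idle, Move.apply]
    · by_cases hj : j = i
      · subst hj
        simp [Memory.act, Memory.setTape]
      · simp [Memory.act, Memory.setTape, hj, idle, Memory.scan]
    · simp [Memory.act, Memory.setTape]
  · intro j
    by_cases hj : j = i
    · subst hj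
      simpa [Memory.setTape] using hb
    · simpa [Memory.setTape, hj] using hm.2 j

/-- The states of the fragments that change a register: moving to the right, deleting the most
significant digit, moving back to the left, and being done. -/
inductive Phase
  | go
  | trim
  | back
  | home

instance : Fintype Phase where
  elems := ⟨[Phase.go, Phase.trim, Phase.back, Phase.home], by simp⟩
  complete := fun c => by cases c <;> simp

/-- The transitions for adding one. -/
def incStep : Phase → Option Bool → Option (Phase × Option Bool × Move)
  | .go, none => some (.back, some false, .left)
  | .go, some false => some (.back, some true, .left)
  | .go, some true => some (.go, some false, .right)
  | .back, none => some (.home, none, .right)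
  | .back, some a => some (.back, some a, .left)
  | _, _ => none

/-- The transitions for subtracting one. -/
def decStep : Phase → Option Bool → Option (Phase × Option Bool × Move)
  | .go, none => some (.trim, none, .left)
  | .go, some true => some (.back, some false, .left)
  | .go, some false => some (.go, some true, .right)
  | .trim, _ => some (.back, none, .left)
  | .back, none => some (.home, none, .right)
  | .back, some a => some (.back, some a, .left)
  | .home, _ => none

/-- Adding one to the number on a work tape. -/
def inc (i : Fin k) : Frag A B (Option Bool) k := oneTape i Phase .go incStep

/-- Subtracting one from the number on a work tape, if the number is positive. -/
def dec (i : Fin k) : Frag A B (Option Bool) k := oneTape i Phase .go decStep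

section Tape

variable {i : Fin k} {x : List A} {b : ℕ} {m : Memory B (Option Bool) k}

/-- Cell `0` is always blank and all digits are nonblank, so the first blank met on the way left
marks the end of the tape. -/
theorem oneTape_back {f : Phase → Option Bool → Option (Phase × Option Bool × Move)}
    (h0 : f .back none = some (.home, none, .right))
    (h1 : ∀ a, f .back (some a) = some (.back, some a, .left)) (hm : m.Ok x b)
    {l : List Bool} {h : ℕ} (hl : h ≤ l.length) (hb : l.length + 1 < b) :
    Relation.ReflTransGen ((oneTape i Phase .go f : Frag A B (Option Bool) k).Step x b)
      (.back, m.setTape i (tapeOf l) h) (.home, m.setTape i (tapeOf l) 1) := by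
  induction h with
  | zero =>
    exact .single (oneTape_step hm h0 (Function.update_eq_self_iff.2 rfl) rfl (by omega))
  | succ h ih =>
    have ht : tapeOf l (h + 1) = some l[h] := List.getElem?_eq_getElem hl
    exact .head (oneTape_step (h' := h) hm (by rw [ht]; exact h1 _) (Function.update_eq_self_iff.2 ht.symm)
      rfl (by omega)) (ih (by omega))

theorem tapeOf_append_nil (p : List Bool) : tapeOf (p ++ []) (p.length + 1) = none := by
  simp [tapeOf]

theorem tapeOf_append_cons (p l : List Bool) (a : Bool) :
    tapeOf (p ++ a :: l) (p.length + 1) = some a := by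
  simp [tapeOf]

/-- Here `p` holds the digits that the carry has already passed. The position where the head turns
back is irrelevant as long as it lies within the digits. -/
theorem inc_go (hm : m.Ok x b) (p l : List Bool)
    (hb : p.length + (succDigits l).length + 1 < b) :
    ∃ h ≤ (p ++ succDigits l).length,
      Relation.ReflTransGen ((inc i : Frag A B (Option Bool) k).Step x b)
        (.go, m.setTape i (tapeOf (p ++ l)) (p.length + 1))
        (.back, m.setTape i (tapeOf (p ++ succDigits l)) h) := by
  induction l generalizing p with
  | nil =>
    refine ⟨p.length, by simp, .single (oneTape_step hm
      (by rw [tapeOf_append_nil]; rfl) ?_ rfl (by simp [succDigits] at hb; omega))⟩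
    rw [List.append_nil]
    exact update_tapeOf_append _ _
  | cons a l ih =>
    cases a with
    | false =>
      exact ⟨p.length, by simp, .single (oneTape_step hm
        (by rw [tapeOf_append_cons]; rfl) (update_tapeOf _ _ _ _) rfl (by omega))⟩
    | true =>
      obtain ⟨h, hh, h'⟩ := ih (p ++ [false]) (by simp [succDigits] at hb ⊢; omega)
      simp only [List.append_assoc, List.singleton_append, List.length_append,
        List.length_singleton] at h'
      exact ⟨h, by simpa [succDigits] using hh, .head (oneTape_step (h' := p.length + 1 + 1) hm
        (by rw [tapeOf_append_cons]; rfl) (update_tapeOf _ _ _ _) rfl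
        (by simp [succDigits] at hb; omega)) h'⟩

theorem dec_go (hm : m.Ok x b) (p l : List Bool)
    (hb : p.length + (succDigits l).length + 1 < b) :
    ∃ h ≤ (p ++ l).length,
      Relation.ReflTransGen ((dec i : Frag A B (Option Bool) k).Step x b)
        (.go, m.setTape i (tapeOf (p ++ succDigits l)) (p.length + 1))
        (.back, m.setTape i (tapeOf (p ++ l)) h) := by
  induction l generalizing p with
  | nil =>
    have h1 : tapeOf (p ++ [true]) (p.length + 1 + 1) = none := by simp [tapeOf]
    simp only [succDigits, List.length_singleton] at hb ⊢
    rw [List.append_nil]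
    -- The borrow has run past the top digit: the blank behind it is seen, and the phase `trim`
    -- deletes that digit.
    exact ⟨p.length, by simp, .head (oneTape_step (h' := p.length + 1 + 1) hm
      (by rw [tapeOf_append_cons]; rfl) (update_tapeOf _ _ _ _) rfl (by omega))
      (.head (oneTape_step (h' := p.length + 1) hm (by rw [h1]; rfl)
      (Function.update_eq_self_iff.2 h1.symm) rfl (by omega)) (.single (oneTape_step hm rfl
      (update_tapeOf_none _ _) rfl (by omega))))⟩
  | cons a l ih =>
    cases a with
    | false =>
      exact ⟨p.length, by simp, .single (oneTape_step hm
        (by rw [succDigits, tapeOf_append_cons]; rfl) (update_tapeOf _ _ _ _) rfl (by omega))⟩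
    | true =>
      obtain ⟨h, hh, h'⟩ := ih (p ++ [true]) (by simp [succDigits] at hb ⊢; omega)
      simp only [List.append_assoc, List.singleton_append, List.length_append,
        List.length_singleton] at h'
      exact ⟨h, by simpa using hh, .head (oneTape_step (h' := p.length + 1 + 1) hm
        (by rw [succDigits, tapeOf_append_cons]; rfl) (update_tapeOf _ _ _ _) rfl
        (by simp [succDigits] at hb; omega)) h'⟩

end Tape

/-- The contents of registers, together with the position of the input head and the output. -/
@[ext]
structure _root_.MonDec.Store (B : Type) (k : ℕ) where
  pos : ℕ
  reg : Fin k → ℕ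
  out : List B

/-- The memory that represents the registers. -/
def _root_.MonDec.Store.memory (s : Store B k) : Memory B (Option Bool) k where
  inputHead := s.pos
  heads := fun _ => 1
  work := fun i => tapeOf (digits (s.reg i))
  output := s.out

theorem exec_inc {x : List A} {b : ℕ} {s : Store B k} {i : Fin k} (hs : s.pos ≤ x.length + 1)
    (hb : (digits (s.reg i + 1)).length + 1 < b) :
    (inc i).Exec x b s.memory
      { s with reg := Function.update s.reg i (s.reg i + 1) : Store B k }.memory := by
  have hm : s.memory.Ok x b := ⟨hs, fun _ => by simp only [Store.memory]; omega⟩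
  obtain ⟨h, hh, h1⟩ := inc_go (i := i) hm [] (digits (s.reg i)) (by simpa [digits] using hb)
  have h2 := oneTape_back (A := A) (i := i) (f := incStep) rfl (fun _ => rfl) hm hh
    (by simpa [digits] using hb)
  have e1 : s.memory.setTape i (tapeOf ([] ++ digits (s.reg i))) (List.length ([] : List Bool) + 1) =
      s.memory := by
    ext j
    · rfl
    · simp [Store.memory, Memory.setTape]
    · simp [Store.memory, Memory.setTape]
    · rfl
  have e2 : s.memory.setTape i (tapeOf ([] ++ succDigits (digits (s.reg i)))) 1 =
      { s with reg := Function.update s.reg i (s.reg i + 1) : Store B k }.memory := by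
    ext j
    · rfl
    · simp [Store.memory, Memory.setTape]
    · by_cases hj : j = i
      · subst hj
        simp [Store.memory, Memory.setTape, digits]
      · simp [Store.memory, Memory.setTape, hj]
    · rfl
  rw [e1] at h1
  rw [e2] at h2
  exact ⟨hm, .home, h1.trans h2, rfl⟩

theorem exec_dec {x : List A} {b : ℕ} {s : Store B k} {i : Fin k} {v : ℕ} (hv : s.reg i = v + 1)
    (hs : s.pos ≤ x.length + 1) (hb : (digits (s.reg i)).length + 1 < b) :
    (dec i).Exec x b s.memory
      { s with reg := Function.update s.reg i v : Store B k }.memory := by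
  have hm : s.memory.Ok x b := ⟨hs, fun _ => by simp only [Store.memory]; omega⟩
  rw [hv, digits] at hb
  obtain ⟨h, hh, h1⟩ := dec_go (i := i) hm [] (digits v) (by simpa using hb)
  have h2 := oneTape_back (A := A) (i := i) (f := decStep) rfl (fun _ => rfl) hm hh
    (by have := length_le_length_succDigits (digits v); simp; omega)
  have e1 : s.memory.setTape i (tapeOf ([] ++ succDigits (digits v)))
      (List.length ([] : List Bool) + 1) = s.memory := by
    ext j
    · rfl
    · simp [Store.memory, Memory.setTape]
    · by_cases hj : j = i
      · subst hj
        simp [Store.memory, Memory.setTape, hv, digits]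
      · simp [Store.memory, Memory.setTape, hj]
    · rfl
  have e2 : s.memory.setTape i (tapeOf ([] ++ digits v)) 1 =
      { s with reg := Function.update s.reg i v : Store B k }.memory := by
    ext j
    · rfl
    · simp [Store.memory, Memory.setTape]
    · by_cases hj : j = i
      · subst hj
        simp [Store.memory, Memory.setTape]
      · simp [Store.memory, Memory.setTape, hj]
    · rfl
  rw [e1] at h1
  rw [e2] at h2
  exact ⟨hm, .home, h1.trans h2, rfl⟩

/-- In bijective base two, zero is the empty word and every other number is not, so the cell at the
resting position of the head decides. -/
theorem scan_memory {s : Store B k} {i : Fin k} : s.memory.scan i = none ↔ s.reg i = 0 := by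
  cases h : s.reg i with
  | zero => simp [Store.memory, Memory.scan, h, digits, tapeOf]
  | succ n => simp [Store.memory, Memory.scan, h, digits, tapeOf, succDigits_ne_nil]

/-- All heads move one cell to the right. -/
def setup : Frag A B (Option Bool) k where
  State := Bool
  start := false
  next := fun q _ v => if q then none else some (true, .stay, fun i => (v i, .right), none)

theorem exec_setup {x : List A} {b : ℕ} (hb : 1 < b) :
    (setup : Frag A B (Option Bool) k).Exec x b (.initial none)
      (Store.memory ⟨0, fun _ => 0, []⟩) := by
  refine ⟨⟨Nat.zero_le _, fun _ => by simp only [Memory.initial]; omega⟩, true,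
    .single ⟨.stay, fun _ => (none, .right), none, rfl, ?_, fun _ => hb⟩, rfl⟩
  ext i j
  · simp [Memory.act, Memory.initial, Store.memory, Move.apply]
  · simp [Memory.act, Memory.initial, Store.memory, Move.apply]
  · cases j <;> simp [Memory.act, Memory.initial, Store.memory, digits, tapeOf]
  · simp [Memory.act, Memory.initial, Store.memory]

end Frag

open Classical in
noncomputable instance {A : Type} [Fintype A] : Fintype (InputSym A) :=
  Fintype.ofSurjective
    (fun s : Option (Option A) => match s with
      | none => .leftEnd
      | some none => .rightEnd
      | some (some a) => .letter a) fun s => by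
    cases s with
    | leftEnd => exact ⟨none, rfl⟩
    | letter a => exact ⟨some (some a), rfl⟩
    | rightEnd => exact ⟨some none, rfl⟩

theorem readInput_of_lt {A : Type} {x : List A} {j : ℕ} (hj : j < x.length) :
    Transducer.readInput x (j + 1) = .letter x[j] := by
  simp [Transducer.readInput, hj]

theorem readInput_length {A : Type} {x : List A} :
    Transducer.readInput x (x.length + 1) = .rightEnd := by
  simp [Transducer.readInput]

theorem readInput_succ_ne {A : Type} {x : List A} {j : ℕ} :
    Transducer.readInput x (j + 1) ≠ .leftEnd := by
  simp only [Transducer.readInput]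
  split <;> simp

namespace Frag

/-! ### Programs for a machine with registers -/

section Program

variable {A B : Type} {k : ℕ} {x : List A} {b : ℕ}

theorem memory_ok {s : Store B k} (hs : s.pos ≤ x.length + 1) (hb : 1 < b) : s.memory.Ok x b :=
  ⟨hs, fun _ => hb⟩

/-- Move the input head. -/
def move (d : Move) : Frag A B (Option Bool) k := single d none

theorem exec_move {s : Store B k} (hs : s.pos ≤ x.length + 1) (hb : 1 < b) (d : Move) :
    (move d).Exec x b s.memory
      { s with pos := min (d.apply s.pos) (x.length + 1) : Store B k }.memory := by
  simpa [Store.memory, move] using exec_single (memory_ok hs hb) d none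

/-- Write a word to the output. -/
def emit : List B → Frag A B (Option Bool) k
  | [] => skip
  | a :: l => (single .stay (some a)).seq (emit l)

theorem exec_emit {s : Store B k} (hs : s.pos ≤ x.length + 1) (hb : 1 < b) (l : List B) :
    (emit l).Exec x b s.memory { s with out := s.out ++ l : Store B k }.memory := by
  induction l generalizing s with
  | nil => simpa [emit] using exec_skip (memory_ok hs hb)
  | cons a l ih =>
    have h1 := exec_single (memory_ok hs hb) .stay (some a)
    have h2 : ({ s.memory with
        inputHead := min (Move.stay.apply s.memory.inputHead) (x.length + 1)
        output := s.memory.output ++ (some a).toList } : Memory B (Option Bool) k) =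
        { s with out := s.out ++ [a] : Store B k }.memory := by
      simp [Store.memory, Move.apply, hs]
    rw [h2] at h1
    simpa [emit] using exec_seq h1 (ih (s := { s with out := s.out ++ [a] }) hs)

/-- Repetition of a fragment while a register is not zero. -/
noncomputable def whileReg (i : Fin k) (F : Frag A B (Option Bool) k) :
    Frag A B (Option Bool) k :=
  loop (fun _ v => v i ≠ none) F

theorem exec_whileReg {i : Fin k} {F : Frag A B (Option Bool) k} {f : ℕ → Store B k} {n : ℕ}
    (h0 : (f 0).pos ≤ x.length + 1) (hb : 1 < b) (hreg : ∀ j ≤ n, (f j).reg i = n - j)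
    (hF : ∀ j < n, F.Exec x b (f j).memory (f (j + 1)).memory) :
    (whileReg i F).Exec x b (f 0).memory (f n).memory := by
  refine exec_loop (m := fun j => (f j).memory) hF (fun j hj => ?_) ?_ (memory_ok h0 hb)
  · rw [ne_eq, scan_memory, hreg j hj.le]
    omega
  · rw [not_not, scan_memory, hreg n le_rfl, Nat.sub_self]

/-- All numbers up to `N` fit into the first `b` cells of a work tape. -/
def _root_.MonDec.Fits (b N : ℕ) : Prop := ∀ v ≤ N, (digits v).length + 1 < b

theorem _root_.MonDec.Fits.one_lt {b N : ℕ} (h : Fits b N) : 1 < b := by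
  simpa [digits] using h 0 (Nat.zero_le _)

variable {N : ℕ}

/-- Move the number in register `i` to register `j`, and write a copy of the word `l` to the output
for each unit. -/
noncomputable def transfer (i j : Fin k) (l : List B) : Frag A B (Option Bool) k :=
  whileReg i ((dec i).seq ((inc j).seq (emit l)))

/-- The sum of the two registers is invariant, so its bound by `N` makes every intermediate value
fit. -/
theorem exec_transfer (hN : Fits b N) {i j : Fin k} (hij : i ≠ j) {s : Store B k}
    (hs : s.pos ≤ x.length + 1) (h : s.reg i + s.reg j ≤ N) (l : List B) :
    (transfer i j l).Exec x b s.memory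
      { s with reg := Function.update (Function.update s.reg i 0) j (s.reg j + s.reg i)
               out := s.out ++ (List.replicate (s.reg i) l).flatten : Store B k }.memory := by
  let f : ℕ → Store B k := fun t =>
    { s with reg := Function.update (Function.update s.reg i (s.reg i - t)) j (s.reg j + t)
             out := s.out ++ (List.replicate t l).flatten }
  have hi : ∀ t, (f t).reg i = s.reg i - t := fun t => by simp [f, hij]
  have hj : ∀ t, (f t).reg j = s.reg j + t := fun t => by simp [f]
  have h0 : f 0 = s := by
    ext1
    · rfl
    · simp [f]
    · simp [f]
  have hn : f (s.reg i) =
      { s with reg := Function.update (Function.update s.reg i 0) j (s.reg j + s.reg i)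
               out := s.out ++ (List.replicate (s.reg i) l).flatten } := by
    simp [f]
  suffices key : (transfer i j l).Exec x b (f 0).memory (f (s.reg i)).memory by
    rwa [hn, h0] at key
  refine exec_whileReg hs hN.one_lt (fun t _ => hi t) fun t ht => ?_
  have h1 := exec_dec (x := x) (b := b) (s := f t) (i := i) (v := s.reg i - (t + 1))
    (by rw [hi]; omega) hs (hN _ (by rw [hi]; omega))
  have h2 := exec_inc (A := A) (x := x) (b := b)
    (s := { f t with reg := Function.update (f t).reg i (s.reg i - (t + 1)) }) (i := j) hs
    (hN _ (by simp only [ne_eq, hij.symm, not_false_eq_true, Function.update_of_ne, hj]; omega))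
  refine exec_seq h1 (exec_seq h2 ?_)
  convert exec_emit (A := A) (x := x) (b := b)
    (s := { f t with reg := Function.update (Function.update (f t).reg i (s.reg i - (t + 1))) j
                      (s.reg j + (t + 1)) }) hs hN.one_lt l using 2
  · ext1
    · rfl
    · simp [f, hij.symm, Nat.add_assoc]
    · rfl
  ext1
  · rfl
  · funext c
    by_cases hc : c = j
    · subst hc
      simp [f]
    · by_cases hc' : c = i
      · subst hc'
        simp [f, hij]
      · simp [f, hc, hc']
  · simp [f, List.replicate_succ']

/-- Write a copy of the word `l` to the output for each unit in register `i`, where `j` is an empty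
register. -/
noncomputable def emitReg (i j : Fin k) (l : List B) : Frag A B (Option Bool) k :=
  (transfer i j l).seq (transfer j i [])

/-- Counting out a register empties it; the second transfer, which writes nothing, restores it from
the scratch register. -/
theorem exec_emitReg (hN : Fits b N) {i j : Fin k} (hij : i ≠ j) {s : Store B k}
    (hs : s.pos ≤ x.length + 1) (h : s.reg i ≤ N) (h0 : s.reg j = 0) (l : List B) :
    (emitReg i j l).Exec x b s.memory
      { s with out := s.out ++ (List.replicate (s.reg i) l).flatten : Store B k }.memory := by
  have h1 := exec_transfer (A := A) (x := x) hN hij hs (by omega) l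
  have h2 := exec_transfer (A := A) (x := x) hN hij.symm (s :=
    { s with reg := Function.update (Function.update s.reg i 0) j (s.reg j + s.reg i)
             out := s.out ++ (List.replicate (s.reg i) l).flatten }) hs
    (by simpa [hij, h0] using h) []
  refine exec_seq h1 ?_
  convert h2 using 2
  ext1
  · rfl
  · funext c
    by_cases hc : c = i
    · subst hc
      simp [hij, h0]
    · by_cases hc' : c = j
      · subst hc'
        simp [hc, h0]
      · simp [hc, hc']
  · simp

/-! ### Arithmetic with three registers -/

/-- Three registers. -/
def _root_.MonDec.Store.three (p a c d : ℕ) (o : List B) : Store B 3 := ⟨p, ![a, c, d], o⟩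

/-- Add a constant to the first register. -/
def addConst : ℕ → Frag A B (Option Bool) 3
  | 0 => skip
  | n + 1 => (inc 0).seq (addConst n)

theorem exec_inc_zero (hN : Fits b N) {p a c d : ℕ} {o : List B} (hp : p ≤ x.length + 1)
    (h : a + 1 ≤ N) :
    (inc 0).Exec x b (Store.three p a c d o).memory (Store.three p (a + 1) c d o).memory := by
  convert exec_inc (A := A) (x := x) (s := Store.three p a c d o) (i := 0) hp (hN _ h) using 2
  ext i <;> try rfl
  fin_cases i <;> rfl

theorem exec_dec_zero (hN : Fits b N) {p a c d : ℕ} {o : List B} (hp : p ≤ x.length + 1)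
    (h : a + 1 ≤ N) :
    (dec 0).Exec x b (Store.three p (a + 1) c d o).memory (Store.three p a c d o).memory := by
  convert exec_dec (A := A) (x := x) (s := Store.three p (a + 1) c d o) (i := 0) rfl hp (hN _ h)
    using 2
  ext i <;> try rfl
  fin_cases i <;> rfl

theorem exec_dec_one (hN : Fits b N) {p a c d : ℕ} {o : List B} (hp : p ≤ x.length + 1)
    (h : c + 1 ≤ N) :
    (dec 1).Exec x b (Store.three p a (c + 1) d o).memory (Store.three p a c d o).memory := by
  convert exec_dec (A := A) (x := x) (s := Store.three p a (c + 1) d o) (i := 1) rfl hp (hN _ h)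
    using 2
  ext i <;> try rfl
  fin_cases i <;> rfl

theorem exec_inc_two (hN : Fits b N) {p a c d : ℕ} {o : List B} (hp : p ≤ x.length + 1)
    (h : d + 1 ≤ N) :
    (inc 2).Exec x b (Store.three p a c d o).memory (Store.three p a c (d + 1) o).memory := by
  convert exec_inc (A := A) (x := x) (s := Store.three p a c d o) (i := 2) hp (hN _ h) using 2
  ext i <;> try rfl
  fin_cases i <;> rfl

theorem exec_addConst (hN : Fits b N) {p a c d : ℕ} {o : List B} (hp : p ≤ x.length + 1) (n : ℕ)
    (h : a + n ≤ N) :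
    (addConst n).Exec x b (Store.three p a c d o).memory (Store.three p (a + n) c d o).memory := by
  induction n generalizing a with
  | zero => exact exec_skip (memory_ok hp hN.one_lt)
  | succ n ih =>
    have := ih (a := a + 1) (by omega)
    rw [Nat.add_right_comm] at this
    exact exec_seq (exec_inc_zero hN hp (by omega)) this

/-- Add the length of the input to the first register. -/
noncomputable def addLength : Frag A B (Option Bool) 3 :=
  (move .right).seq ((loop (fun s _ => s ≠ .rightEnd) ((inc 0).seq (move .right))).seq
    (loop (fun s _ => s ≠ .leftEnd) (move .left)))

theorem exec_addLength (hN : Fits b N) {a c d : ℕ} {o : List B} (h : a + x.length ≤ N) :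
    addLength.Exec x b (Store.three 0 a c d o).memory
      (Store.three 0 (a + x.length) c d o).memory := by
  have hb := hN.one_lt
  have h1 : (move .right).Exec x b (Store.three 0 a c d o).memory
      (Store.three 1 (a + 0) c d o).memory := by
    simpa [Store.three, Move.apply] using
      exec_move (x := x) (s := Store.three 0 a c d o) (Nat.zero_le _) hb .right
  refine exec_seq h1 (exec_seq (m₁ := (Store.three (x.length + 1) (a + x.length) c d o).memory)
    ?_ ?_)
  · refine exec_loop (m := fun j => (Store.three (j + 1) (a + j) c d o).memory)
      (fun j hj => ?_) (fun j hj => ?_) ?_ (memory_ok (by simp [Store.three]) hb)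
    · refine exec_seq (exec_inc_zero hN (by omega) (by omega)) ?_
      have := exec_move (x := x) (s := Store.three (j + 1) (a + j + 1) c d o)
        (by simp only [Store.three]; omega) hb .right
      simpa [Store.three, Move.apply, Nat.add_assoc, hj] using this
    · simp [Memory.sym, Store.memory, Store.three, readInput_of_lt hj]
    · simp [Memory.sym, Store.memory, Store.three, readInput_length]
  -- The head walks back from the right to the left end marker, `x.length + 1` cells, so that the
  -- fragment can be used again.
  · have := exec_loop (F := move .left) (x := x) (b := b) (p := fun s _ => s ≠ .leftEnd)
      (m := fun j => (Store.three (x.length + 1 - j) (a + x.length) c d o).memory)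
      (n := x.length + 1) (fun j hj => ?_) (fun j hj => ?_) ?_ (memory_ok (by simp [Store.three]) hb)
    · simpa using this
    · have := exec_move (x := x) (s := Store.three (x.length + 1 - j) (a + x.length) c d o)
        (by simp only [Store.three]; omega) hb .left
      have hmin : min (x.length + 1 - j - 1) (x.length + 1) = x.length + 1 - (j + 1) := by omega
      simpa only [Store.three, Move.apply, hmin] using this
    · obtain ⟨i, hi⟩ : ∃ i, x.length + 1 - j = i + 1 := ⟨x.length - j, by omega⟩
      simpa [Memory.sym, Store.memory, Store.three, hi] using readInput_succ_ne
    · simp [Memory.sym, Store.memory, Store.three, Transducer.readInput]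

/-- Multiply the first register by `n + c`, where `n` is the length of the input. -/
noncomputable def mulLength (c : ℕ) : Frag A B (Option Bool) 3 :=
  (transfer 0 1 []).seq (whileReg 1 ((dec 1).seq ((addConst c).seq addLength)))

theorem exec_mulLength (hN : Fits b N) {a c : ℕ} {o : List B} (ha : a ≤ N)
    (h : a * (x.length + c) ≤ N) :
    (mulLength c).Exec x b (Store.three 0 a 0 0 o).memory
      (Store.three 0 (a * (x.length + c)) 0 0 o).memory := by
  have hb := hN.one_lt
  have h1 : (transfer 0 1 []).Exec x b (Store.three 0 a 0 0 o).memory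
      (Store.three 0 0 a 0 o).memory := by
    convert exec_transfer (A := A) (x := x) (i := 0) (j := 1) hN (by decide)
      (s := Store.three 0 a 0 0 o) (Nat.zero_le _) (by simpa [Store.three] using ha) [] using 2
    ext i <;> simp [Store.three]
    fin_cases i <;> simp
  refine exec_seq h1 ?_
  -- After `j` rounds the first register holds `j` summands, and the second one counts those still
  -- missing.
  have := exec_whileReg (A := A) (x := x) (b := b) (i := 1)
    (F := (dec 1).seq ((addConst c).seq addLength))
    (f := fun j => Store.three 0 (j * (x.length + c)) (a - j) 0 o) (n := a) (Nat.zero_le _) hb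
    (fun j _ => rfl) (fun j hj => ?_)
  · simpa using this
  · have hle : (j + 1) * (x.length + c) ≤ a * (x.length + c) := Nat.mul_le_mul_right _ hj
    rw [Nat.succ_mul] at hle
    have h2 := exec_dec_one (A := A) (B := B) (x := x) (p := 0) (a := j * (x.length + c))
      (c := a - (j + 1)) (d := 0) (o := o) hN (Nat.zero_le _) (by omega)
    rw [show a - (j + 1) + 1 = a - j by omega] at h2
    refine exec_seq h2 (exec_seq (exec_addConst hN (Nat.zero_le _) c (by omega)) ?_)
    rw [Nat.succ_mul, show j * (x.length + c) + (x.length + c) =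
      j * (x.length + c) + c + x.length by ring]
    exact exec_addLength hN (by omega)

/-- Set the first register to `(n + c) ^ e`, where `n` is the length of the input. -/
noncomputable def power (c : ℕ) : ℕ → Frag A B (Option Bool) 3
  | 0 => inc 0
  | e + 1 => (power c e).seq (mulLength c)

/-- Since `c` is positive the powers do not decrease, so all intermediate ones are bounded by the
last. -/
theorem exec_power (hN : Fits b N) {c : ℕ} (hc : 0 < c) {e : ℕ} {o : List B}
    (h : (x.length + c) ^ e ≤ N) :
    (power c e).Exec x b (Store.three 0 0 0 0 o).memory
      (Store.three 0 ((x.length + c) ^ e) 0 0 o).memory := by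
  induction e with
  | zero => exact exec_inc_zero hN (Nat.zero_le _) h
  | succ e ih =>
    have hle : (x.length + c) ^ e ≤ (x.length + c) ^ (e + 1) :=
      Nat.pow_le_pow_right (by omega) (Nat.le_succ e)
    exact exec_seq (ih (hle.trans h)) (exec_mulLength hN (hle.trans h) h)

end Program

end Frag

open PairNFA (codeNat codeLetter)

theorem flatten_replicate_append_codeNat (K d m : ℕ) :
    (List.replicate d (List.replicate K PairNFA.Code.one)).flatten ++ codeNat m =
      codeNat (K * d + m) := by
  rw [List.flatten_replicate_replicate, codeNat, codeNat, ← List.append_assoc,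
    List.replicate_append_replicate, Nat.mul_comm]

namespace Frag

/-! ### The program that writes the automaton -/

section Automaton

variable {A : Type} {x : List A} {b N L : ℕ}

/-- Write the number of a state whose control state has the number `m` and whose counter is in the
third register. -/
noncomputable def emitState (L m : ℕ) : Frag A PairNFA.Code (Option Bool) 3 :=
  (emitReg 2 1 (List.replicate (controls (Fin L)) .one)).seq (emit (codeNat m))

theorem exec_emitState (hN : Fits b N) {p a d m : ℕ} {o : List PairNFA.Code}
    (hp : p ≤ x.length + 1) (hd : d ≤ N) :
    (emitState L m).Exec x b (Store.three p a 0 d o).memory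
      (Store.three p a 0 d (o ++ codeNat (controls (Fin L) * d + m))).memory := by
  rw [← flatten_replicate_append_codeNat, ← List.append_assoc]
  exact exec_seq (exec_emitReg (A := A) (x := x) hN (i := 2) (j := 1) (by decide)
    (s := Store.three p a 0 d o) hp hd rfl (List.replicate (controls (Fin L)) .one))
    (exec_emit hp hN.one_lt (codeNat m))

/-- Write a transition. -/
noncomputable def emitEntry (t : Entry (Fin L)) : Frag A PairNFA.Code (Option Bool) 3 :=
  (emitState L (controlNum t.1)).seq ((emit (codeLetter t.2.1 ++ codeLetter t.2.2.1)).seq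
    (if t.2.2.2.2 then emitState L (controls (Fin L) + controlNum t.2.2.2.1)
      else emit (codeNat (controlNum t.2.2.2.1))))

theorem exec_emitEntry (hN : Fits b N) {p a d : ℕ} {o : List PairNFA.Code}
    (hp : p ≤ x.length + 1) (hd : d ≤ N) (t : Entry (Fin L)) :
    (emitEntry t).Exec x b (Store.three p a 0 d o).memory
      (Store.three p a 0 d (o ++ codeEntry d t)).memory := by
  obtain ⟨q, l, r, q', i⟩ := t
  refine exec_seq (exec_emitState hN hp hd) (exec_seq (exec_emit hp hN.one_lt _) ?_)
  cases i with
  -- The next value of the counter contributes one more block of `controls (Fin L)` ones, which is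
  -- absorbed into the constant.
  | true =>
    have h := exec_emitState (x := x) (L := L) (a := a) (m := controls (Fin L) + controlNum q')
      (o := o ++ codeNat (controls (Fin L) * d + controlNum q) ++ (codeLetter l ++ codeLetter r))
      hN hp hd
    simpa [codeEntry, Store.three, Nat.mul_succ, Nat.add_assoc] using h
  | false =>
    have h := exec_emit (x := x) (s := Store.three p a 0 d
      (o ++ codeNat (controls (Fin L) * d + controlNum q) ++ (codeLetter l ++ codeLetter r)))
      hp hN.one_lt (codeNat (controlNum q'))
    simpa [codeEntry, Store.three] using h

/-- Write a list of transitions. -/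
noncomputable def emitEntries : List (Entry (Fin L)) → Frag A PairNFA.Code (Option Bool) 3
  | [] => skip
  | t :: l => (emitEntry t).seq (emitEntries l)

theorem exec_emitEntries (hN : Fits b N) {p a d : ℕ} {o : List PairNFA.Code}
    (hp : p ≤ x.length + 1) (hd : d ≤ N) (l : List (Entry (Fin L))) :
    (emitEntries l).Exec x b (Store.three p a 0 d o).memory
      (Store.three p a 0 d (o ++ l.flatMap (codeEntry d))).memory := by
  induction l generalizing o with
  | nil => simpa [emitEntries] using exec_skip (memory_ok hp hN.one_lt)
  | cons t l ih => simpa [emitEntries] using exec_seq (exec_emitEntry hN hp hd t) ih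

variable [Fintype A]

/-- Proceed to the next value of the counter and the next letter of the input, and write a list of
transitions that depends on that letter. -/
noncomputable def emitNext (f : InputSym A → List (Entry (Fin L))) :
    Frag A PairNFA.Code (Option Bool) 3 :=
  (inc 2).seq ((move .right).seq (branch fun s => emitEntries (f s)))

/-- Input head and counter advance together; once the counter exceeds the length of the input, the
head rests on the right end marker, which later stands for a blank cell. -/
theorem exec_emitNext (hN : Fits b N) {a d : ℕ} {o : List PairNFA.Code} (hd : d + 1 ≤ N)
    (f : InputSym A → List (Entry (Fin L))) :
    (emitNext f).Exec x b (Store.three (min d (x.length + 1)) a 0 d o).memory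
      (Store.three (min (d + 1) (x.length + 1)) a 0 (d + 1)
        (o ++ (f (Transducer.readInput x (min (d + 1) (x.length + 1)))).flatMap
          (codeEntry (d + 1)))).memory := by
  refine exec_seq (exec_inc_two hN (min_le_right _ _) hd) (exec_seq
    (m₁ := (Store.three (min (d + 1) (x.length + 1)) a 0 (d + 1) o).memory) ?_ ?_)
  · have h := exec_move (x := x) (s := Store.three (min d (x.length + 1)) a 0 (d + 1) o)
      (min_le_right _ _) hN.one_lt .right
    have hmin : min (min d (x.length + 1) + 1) (x.length + 1) = min (d + 1) (x.length + 1) := by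
      omega
    simpa only [Store.three, Move.apply, hmin] using h
  · exact exec_branch (exec_emitEntries hN (min_le_right _ _) hd _)

/-- Write an automaton with `(n + c) ^ e + 3` values of the counter, where `n` is the length of the
input. The words `h₁` and `h₂` are written before and after the number of states. The transitions
are given by four lists, for the values `0` and `1` of the counter, for the others, and for the
last. -/
noncomputable def emitAutomaton (c e : ℕ) (h₁ h₂ : List PairNFA.Code)
    (first last : List (Entry (Fin L))) (mid₁ mid₂ : InputSym A → List (Entry (Fin L))) :
    Frag A PairNFA.Code (Option Bool) 3 :=
  setup.seq <| (power c e).seq <| (emit h₁).seq <|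
    (emitReg 0 1 (List.replicate (controls (Fin L)) .one)).seq <|
    (emit (codeNat (3 * controls (Fin L)) ++ h₂)).seq <| (emitEntries first).seq <|
    (emitNext mid₁).seq <| (whileReg 0 ((dec 0).seq (emitNext mid₂))).seq <| (inc 2).seq <|
    emitEntries last

theorem exec_emitAutomaton {c e : ℕ} (hN : Fits b ((x.length + c) ^ e + 2)) (hc : 0 < c)
    (h₁ h₂ : List PairNFA.Code) (first last : List (Entry (Fin L)))
    (mid₁ mid₂ : InputSym A → List (Entry (Fin L))) :
    ∃ m, (emitAutomaton c e h₁ h₂ first last mid₁ mid₂).Exec x b (.initial none) m ∧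
      m.output = h₁ ++ (codeNat (((x.length + c) ^ e + 3) * controls (Fin L)) ++ (h₂ ++
        (first.flatMap (codeEntry 0) ++
          ((mid₁ (Transducer.readInput x (min 1 (x.length + 1)))).flatMap (codeEntry 1) ++
            ((List.range ((x.length + c) ^ e)).flatMap (fun j =>
              (mid₂ (Transducer.readInput x (min (j + 2) (x.length + 1)))).flatMap
                (codeEntry (j + 2))) ++
              last.flatMap (codeEntry ((x.length + c) ^ e + 2))))))) := by
  set E := (x.length + c) ^ e with hE
  have hb := hN.one_lt
  have s0 : (setup : Frag A PairNFA.Code (Option Bool) 3).Exec x b (.initial none)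
      (Store.three 0 0 0 0 []).memory := by
    have e0 : (Store.three 0 0 0 0 [] : Store PairNFA.Code 3) = ⟨0, fun _ => 0, []⟩ := by
      ext i <;> try rfl
      fin_cases i <;> rfl
    rw [e0]
    exact exec_setup hb
  have s1 := exec_power (x := x) (o := ([] : List PairNFA.Code)) hN hc (e := e) (by omega)
  rw [← hE] at s1
  have s2 := exec_emit (x := x) (s := Store.three 0 E 0 0 []) (Nat.zero_le _) hb h₁
  have s3 := exec_emitReg (A := A) (x := x) hN (i := 0) (j := 1) (by decide)
    (s := Store.three 0 E 0 0 h₁) (Nat.zero_le _) (by simp [Store.three]) rfl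
    (List.replicate (controls (Fin L)) .one)
  have s4 := exec_emit (A := A) (x := x) (s := Store.three 0 E 0 0
    (h₁ ++ (List.replicate E (List.replicate (controls (Fin L)) PairNFA.Code.one)).flatten))
    (Nat.zero_le _) hb (codeNat (3 * controls (Fin L)) ++ h₂)
  -- The number of states is written as `E` blocks of ones and a constant for the three remaining
  -- values of the counter.
  have e4 : h₁ ++ (List.replicate E (List.replicate (controls (Fin L)) PairNFA.Code.one)).flatten ++
      (codeNat (3 * controls (Fin L)) ++ h₂) =
        h₁ ++ (codeNat ((E + 3) * controls (Fin L)) ++ h₂) := by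
    rw [List.append_assoc, ← List.append_assoc _ (codeNat _), flatten_replicate_append_codeNat,
      Nat.add_mul, Nat.mul_comm E]
  have s4 : (emit (codeNat (3 * controls (Fin L)) ++ h₂)).Exec x b _
    (Store.three 0 E 0 0 (h₁ ++ (codeNat ((E + 3) * controls (Fin L)) ++ h₂))).memory := e4 ▸ s4
  set o := h₁ ++ (codeNat ((E + 3) * controls (Fin L)) ++ h₂) with ho
  have s5 := exec_emitEntries (x := x) (a := E) (o := o) hN (Nat.zero_le _) (Nat.zero_le _) first
  have s6 := exec_emitNext (x := x) (a := E) (d := 0) (o := o ++ first.flatMap (codeEntry 0)) hN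
    (by omega) mid₁
  set o' := o ++ first.flatMap (codeEntry 0) ++
    (mid₁ (Transducer.readInput x (min (0 + 1) (x.length + 1)))).flatMap (codeEntry (0 + 1)) with ho'
  -- Before round `j` the counter is `j + 1`, and the round treats the value `j + 2`. The loop ends
  -- at `E + 1`, which leaves the last value `E + 2`.
  let f : ℕ → Store PairNFA.Code 3 := fun j => Store.three (min (j + 1) (x.length + 1)) (E - j) 0
    (j + 1) (o' ++ (List.range j).flatMap (fun j =>
      (mid₂ (Transducer.readInput x (min (j + 2) (x.length + 1)))).flatMap (codeEntry (j + 2))))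
  have s7 := exec_whileReg (A := A) (x := x) (b := b) (i := 0)
    (F := (dec 0).seq (emitNext mid₂)) (f := f) (n := E) (min_le_right _ _) hb
    (fun _ _ => rfl) (fun j hj => by
      have h1 := exec_dec_zero (A := A) (x := x) (p := min (j + 1) (x.length + 1))
        (a := E - (j + 1)) (c := 0) (d := j + 1) (o := (f j).out) hN (min_le_right _ _) (by omega)
      rw [show E - (j + 1) + 1 = E - j by omega] at h1
      refine exec_seq h1 ?_
      have h2 := exec_emitNext (x := x) (a := E - (j + 1)) (d := j + 1) (o := (f j).out) hN
        (by omega) mid₂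
      have e2 : f (j + 1) = Store.three (min (j + 2) (x.length + 1)) (E - (j + 1)) 0 (j + 2)
          ((f j).out ++ (mid₂ (Transducer.readInput x (min (j + 2) (x.length + 1)))).flatMap
            (codeEntry (j + 2))) := by
        simp only [f, List.range_succ, List.flatMap_append, List.flatMap_cons, List.flatMap_nil,
          List.append_nil, ← List.append_assoc]
        rfl
      rw [e2]
      exact h2)
  have s8 := exec_inc_two (A := A) (x := x) (p := (f E).pos) (a := E - E) (c := 0) (d := E + 1)
    (o := (f E).out) hN (min_le_right _ _) (by omega)
  have s9 := exec_emitEntries (x := x) (p := (f E).pos) (a := E - E) (o := (f E).out) hN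
    (min_le_right _ _) (d := E + 2) (by omega) last
  have f0 : f 0 = Store.three (min (0 + 1) (x.length + 1)) E 0 (0 + 1) o' := by
    simp [f]
  rw [f0] at s7
  refine ⟨_, exec_seq s0 <| exec_seq s1 <| exec_seq s2 <| exec_seq s3 <| exec_seq s4 <|
    exec_seq s5 <| exec_seq s6 <| exec_seq s7 <| exec_seq s8 s9, ?_⟩
  simp [Store.memory, Store.three, f, ho', ho]

end Automaton

end Frag

/-! ### Logarithmic and polynomial bounds -/

/-- Powers of `n + c` fit into logarithmic space. -/
theorem fits_pow (c e n : ℕ) :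
    Fits ((e * (c + 1) + 4) * (Nat.log 2 n + 1)) ((n + c) ^ e + 2) := by
  intro v hv
  have h1 : n < 2 ^ (Nat.log 2 n + 1) := Nat.lt_pow_succ_log_self one_lt_two n
  have h2 : n + c ≤ 2 ^ ((c + 1) * (Nat.log 2 n + 1)) := calc
    n + c ≤ (n + 1) * (c + 1) := by nlinarith
    _ ≤ 2 ^ (Nat.log 2 n + 1) * 2 ^ c := Nat.mul_le_mul h1 (Nat.lt_two_pow_self)
    _ = 2 ^ (Nat.log 2 n + 1 + c) := (pow_add _ _ _).symm
    _ ≤ _ := Nat.pow_le_pow_right two_pos (by nlinarith)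
  have h3 : (n + c) ^ e ≤ 2 ^ (e * (c + 1) * (Nat.log 2 n + 1)) := calc
    (n + c) ^ e ≤ (2 ^ ((c + 1) * (Nat.log 2 n + 1))) ^ e := Nat.pow_le_pow_left h2 e
    _ = _ := by rw [← pow_mul]; ring_nf
  have h4 : 2 ^ (digits v).length ≤ 2 ^ (e * (c + 1) * (Nat.log 2 n + 1) + 2) := by
    have := two_pow_length_digits_le v
    have h0 := Nat.one_le_two_pow (n := e * (c + 1) * (Nat.log 2 n + 1))
    rw [pow_add]
    omega
  have h5 := (Nat.pow_le_pow_iff_right one_lt_two).1 h4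
  nlinarith

open PairNFA (codeNat)

/-! ### The reduction -/

theorem exists_eval_le_pow (p : Polynomial ℕ) :
    ∃ c e : ℕ, 0 < c ∧ ∀ n, p.eval n ≤ (n + c) ^ e := by
  induction p using Polynomial.induction_on' with
  | add p q hp hq =>
    obtain ⟨c, e, hc, h⟩ := hp
    obtain ⟨c', e', hc', h'⟩ := hq
    refine ⟨c + c', max e e' + 1, by omega, fun n => ?_⟩
    have h1 : (n + c) ^ e ≤ (n + (c + c')) ^ max e e' :=
      (Nat.pow_le_pow_left (by omega) e).trans (Nat.pow_le_pow_right (by omega) (le_max_left _ _))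
    have h2 : (n + c') ^ e' ≤ (n + (c + c')) ^ max e e' :=
      (Nat.pow_le_pow_left (by omega) e').trans
        (Nat.pow_le_pow_right (by omega) (le_max_right _ _))
    -- The base is at least `2`, so one more factor absorbs the sum of two equal bounds.
    have h3 : (n + (c + c')) ^ max e e' * 2 ≤ (n + (c + c')) ^ max e e' * (n + (c + c')) :=
      Nat.mul_le_mul_left _ (by omega)
    rw [Polynomial.eval_add, pow_succ]
    have := h n
    have := h' n
    omega
  | monomial k a =>
    refine ⟨a + 1, k + 1, by omega, fun n => ?_⟩
    rw [Polynomial.eval_monomial, pow_succ, Nat.mul_comm]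
    exact Nat.mul_le_mul (Nat.pow_le_pow_left (by omega) k) (by omega)

theorem flatMap_range_add_three {α : Type} (E : ℕ) (g : ℕ → List α) :
    (List.range (E + 3)).flatMap g =
      g 0 ++ (g 1 ++ ((List.range E).flatMap (fun j => g (j + 2)) ++ g (E + 2))) := by
  rw [List.range_succ, List.range_succ_eq_map, List.range_succ_eq_map]
  simp [List.flatMap_map]

namespace TM

attribute [instance] TM.stateFintype TM.auxFintype

variable {A : Type} (M : TM A)

/-- The tape symbol for a symbol on the input tape of a transducer. -/
def tapeSym : InputSym A → Option (A ⊕ M.Aux)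
  | .letter a => some (.inl a)
  | _ => none

/-- The input tape of the transducer is shifted by one because of its left end marker, and its right
end marker stands for all blanks after the input. -/
theorem tapeSym_readInput (x : List A) (j : ℕ) :
    M.tapeSym (Transducer.readInput x (min (j + 1) (x.length + 1))) = x[j]?.map Sum.inl := by
  rcases Nat.lt_or_ge j x.length with h | h
  · rw [min_eq_left (by omega), readInput_of_lt h, List.getElem?_eq_getElem h]
    rfl
  · rw [min_eq_right (by omega), readInput_length, List.getElem?_eq_none h]
    rfl

variable [Fintype A]

/-- The number of letters of the word of all configurations. -/
noncomputable def letters : ℕ := Fintype.card M.Letter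

/-- A numbering of the letters. -/
noncomputable def letterEquiv : M.Letter ≃ Fin M.letters := Fintype.equivFin _

/-- The local rule for numbered letters, where the bad letters are the rejecting ones. -/
noncomputable def rule : Rule (Fin M.letters) where
  next := fun l c r => M.letterEquiv
    (M.localRule (M.letterEquiv.symm l) (M.letterEquiv.symm c) (M.letterEquiv.symm r))
  bad := fun a => M.Rejecting (M.letterEquiv.symm a)
  hash := M.letterEquiv none
  blank := M.letterEquiv (some (none, none))

/-- The word of all configurations, where a configuration takes `D + 2` letters. -/
noncomputable def numWord (x : List A) (D k : ℕ) : Fin M.letters :=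
  M.letterEquiv (M.word x (D + 2) k)

theorem numWord_succ {x : List A} {D j : ℕ} (hj : j ≤ D) : M.numWord x D (j + 1) =
    M.letterEquiv (some (if 0 = j then some M.start else none, x[j]?.map Sum.inl)) := by
  rw [numWord, word_of_lt _ (by omega)]
  rfl

/-- Letter `D + 1` is cell `D` of the first configuration, which lies behind the input and is not
scanned; letter `D + 2` is the second separator. -/
theorem rule_generates {x : List A} {D : ℕ} (hD : x.length ≤ D) (hD' : D ≠ 0)
    (hM : ∀ t, (M.conf x t).head < D) : M.rule.Generates D (M.numWord x D) where
  next := fun i => by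
    have h := M.word_next (x := x) (s := D + 2) (by omega) (fun t => by have := hM t; omega) i
    simp only [rule, numWord, Equiv.symm_apply_apply]
    rw [← h]
  blank := by
    rw [numWord_succ _ le_rfl, if_neg hD'.symm, List.getElem?_eq_none hD]
    rfl
  hash := by
    rw [numWord, word_self]
    rfl

theorem logspaceComputable_encode {c e : ℕ} (hc : 0 < c) (he : ∀ n, n ≤ (n + c) ^ e) :
    LogspaceComputable fun x : List A =>
      (pairNFA M.rule ((x.length + c) ^ e + 2) (M.numWord x ((x.length + c) ^ e + 2))).encode := by
  refine Frag.logspaceComputable_of_exec (blank := none) (c := e * (c + 1) + 4)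
    (F := Frag.emitAutomaton c e (codeNat M.letters)
      (codeNat (controlNum (.check .pos false : Control (Fin M.letters))) ++
        ((finals (Fin M.letters)).flatMap (fun q => codeNat (controlNum q)) ++ [.bar]))
      (entries M.rule true false M.rule.hash) (entries M.rule false true M.rule.blank)
      (fun s => entries M.rule false false (M.letterEquiv (some (some M.start, M.tapeSym s))))
      (fun s => entries M.rule false false (M.letterEquiv (some (none, M.tapeSym s))))) fun x => ?_
  obtain ⟨m, hm, ho⟩ := Frag.exec_emitAutomaton (x := x) (fits_pow c e x.length) hc
    (codeNat M.letters)
      (codeNat (controlNum (.check .pos false : Control (Fin M.letters))) ++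
        ((finals (Fin M.letters)).flatMap (fun q => codeNat (controlNum q)) ++ [.bar]))
      (entries M.rule true false M.rule.hash) (entries M.rule false true M.rule.blank)
      (fun s => entries M.rule false false (M.letterEquiv (some (some M.start, M.tapeSym s))))
      (fun s => entries M.rule false false (M.letterEquiv (some (none, M.tapeSym s))))
  refine ⟨m, hm, ho.trans ?_⟩
  -- The input fits into `E` cells, so the letter for the last value of the counter is blank and
  -- independent of `x`.
  have hE := he x.length
  generalize (x.length + c) ^ e = E at hE
  have h0 : M.numWord x (E + 2) 0 = M.rule.hash := by
    rw [numWord, word_of_lt _ (by omega)]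
    rfl
  have h1 : M.numWord x (E + 2) 1 = M.letterEquiv (some (some M.start,
      M.tapeSym (Transducer.readInput x (min 1 (x.length + 1))))) := by
    have := M.tapeSym_readInput x 0
    rw [numWord_succ _ (Nat.zero_le _), if_pos rfl, ← this]
  have h2 : ∀ j ∈ List.range E, M.numWord x (E + 2) (j + 2) = M.letterEquiv (some (none,
      M.tapeSym (Transducer.readInput x (min (j + 2) (x.length + 1))))) := by
    intro j hj
    have hj := List.mem_range.1 hj
    have := M.tapeSym_readInput x (j + 1)
    rw [numWord_succ _ (by omega), if_neg (by omega), ← this]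
  have h3 : M.numWord x (E + 2) (E + 2) = M.rule.blank := by
    rw [numWord_succ _ (by omega), if_neg (by omega), List.getElem?_eq_none (by omega)]
    rfl
  have h4 : (List.range E).flatMap (fun j => (entries M.rule (decide (j + 2 = 0))
      (decide (j + 2 = E + 2)) (M.numWord x (E + 2) (j + 2))).flatMap (codeEntry (j + 2))) =
      (List.range E).flatMap (fun j => (entries M.rule false false (M.letterEquiv (some (none,
        M.tapeSym (Transducer.readInput x (min (j + 2) (x.length + 1))))))).flatMap
          (codeEntry (j + 2))) := by
    rw [List.flatMap_def, List.flatMap_def]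
    congr 1
    refine List.map_congr_left fun j hj => ?_
    rw [h2 j hj, decide_eq_false (by omega), decide_eq_false]
    have := List.mem_range.1 hj
    omega
  rw [encode_pairNFA, flatMap_range_add_three, h4, h0, h1, h3, decide_eq_true rfl,
    decide_eq_false (show ¬ 0 = E + 2 by omega), decide_eq_false (show ¬ 1 = 0 by omega),
    decide_eq_false (show ¬ 1 = E + 2 by omega), decide_eq_false (show ¬ E + 2 = 0 by omega),
    decide_eq_true rfl]
  simp only [List.append_assoc, List.singleton_append]

end TM

end MonDec

/-- Deciding whether a binary regular relation given by a nondeterministic finite automaton is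
monadic decomposable is PSPACE-hard under logarithmic space many-one reductions. -/
theorem mainTheorem5 : MonDec.PSPACEHard MonDec.monadicDecomposability := by
  rintro A _ L ⟨M, p, hL, hM⟩
  -- The summand `X` makes the bound dominate the length of the input as well as the space.
  obtain ⟨c, e, hc, hp⟩ := MonDec.exists_eval_le_pow (p + Polynomial.X)
  have hp : ∀ n, p.eval n + n ≤ (n + c) ^ e := by simpa using hp
  have hgen : ∀ x : List A, M.rule.Generates ((x.length + c) ^ e + 2)
      (M.numWord x ((x.length + c) ^ e + 2)) := fun x => by
    have := hp x.length
    exact M.rule_generates (by omega) (by omega) fun t => by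
      have : (M.conf x t).head < p.eval x.length := hM x t
      omega
  refine ⟨fun x => ⟨MonDec.pairNFA M.rule ((x.length + c) ^ e + 2)
      (M.numWord x ((x.length + c) ^ e + 2)), _, MonDec.pairNFA_defines (hgen x) (by omega)⟩,
    M.logspaceComputable_encode hc fun n => by have := hp n; omega, fun x => ?_⟩
  refine Iff.trans ?_ (MonDec.yes_pairNFA (hgen x) (by omega)).symm
  rw [M.mem_iff_not_rejecting hL, ← M.rejecting_word (s := (x.length + c) ^ e + 2 + 2), not_exists]
  · simp only [MonDec.TM.rule, MonDec.TM.numWord, Equiv.symm_apply_apply]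
  · intro t
    have : (M.conf x t).head < p.eval x.length := hM x t
    have := hp x.length
    omega
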